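/- Conventions. An algebra $A$ is a set with a family (of any type) of finitary basic operations. $\mathrm{Con}\,A$ is the lattice of congruences of $A$ (the equivalence relations preserved by all basic operations) ordered by inclusion, and $A$ is congruence distributive if $\mathrm{Con}\,A$ is distributive. The energy of a finite simple graph is the sum of the absolute values of the eigenvalues (with multiplicity) of its adjacency matrix. For a congruence $\alpha$ of a finite algebra $A$, let $\mathrm{En}(\alpha)$ be the energy of the graph on $A$ in which $x\neq y$ are joined by an edge iff $(x,y)\in\alpha$, and let $\mathrm{CE}(A)=\sum_{\alpha\in\mathrm{Con}\,A}\mathrm{En}(\alpha)$. Lattices are regarded as algebras with the operations meet and join. A chain is a lattice in which any two elements are comparable; $B_4$ is the four-element boolean lattice; the glued sum $U\dotplus V$ of disjoint finite lattices $U,V$ is $U\cup(V\setminus\{0_V\})$, where $U$ and $V\setminus\{0_V\}$ keep their orders and every element of $U$ is below every element of $V\setminus\{0_V\}$. Theorem. For every positive integer $n$ the following hold. (a) Let $A$ be an $n$-element congruence distributive algebra. Then $\mathrm{CE}(A)\le (n-1)2^{n-1}$. If $\mathrm{CE}(A)=(n-1)2^{n-1}$, then $\mathrm{Con}\,A$ is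 a boolean lattice and $|\mathrm{Con}\,A|=2^{n-1}$. (b) Let $L$ be an $n$-element lattice. Then $\mathrm{CE}(L)\le (n-1)2^{n-1}$, and $\mathrm{CE}(L)=(n-1)2^{n-1}$ if and only if $L$ is a chain. (c) Let $L$ be an $n$-element lattice with $\mathrm{CE}(L)<(n-1)2^{n-1}$ (by (b), this means that $L$ is not a chain). Then $n\ge 4$ and $\mathrm{CE}(L)\le (n-1)2^{n-2}+2^{n-3}$. Moreover, $\mathrm{CE}(L)=(n-1)2^{n-2}+2^{n-3}$ if and only if $L$ has exactly one $2$-element antichain. Equivalently, $\mathrm{CE}(L)=(n-1)2^{n-2}+2^{n-3}$ if and only if $L\cong C'\dotplus B_4\dotplus C''$ for some finite (nonempty) chains $C'$ and $C''$. -/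

import Mathlib

universe u v w

noncomputable section

/-! ### Congruences of algebras -/

/-- An equivalence relation `s` on (the carrier of) an algebra `A` with operation symbols in `𝓛` is
compatible if every finitary basic operation of `A` preserves it. -/
def IsCongruence (𝓛 : FirstOrder.Language.{u, v}) {A : Type w} [𝓛.Structure A]
    (s : Setoid A) : Prop :=
  ∀ (k : ℕ) (f : 𝓛.Functions k) (x y : Fin k → A), (∀ i, s (x i) (y i)) →
    s (FirstOrder.Language.Structure.funMap f x) (FirstOrder.Language.Structure.funMap f y)

theorem IsCongruence.inf {𝓛 : FirstOrder.Language.{u, v}} {A : Type w} [𝓛.Structure A]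
    {s t : Setoid A} (hs : IsCongruence 𝓛 s) (ht : IsCongruence 𝓛 t) :
    IsCongruence 𝓛 (s ⊓ t) :=
  fun k f x y h => ⟨hs k f x y fun i => (h i).1, ht k f x y fun i => (h i).2⟩

theorem IsCongruence.sup {𝓛 : FirstOrder.Language.{u, v}} {A : Type w} [𝓛.Structure A]
    {s t : Setoid A} (hs : IsCongruence 𝓛 s) (ht : IsCongruence 𝓛 t) :
    IsCongruence 𝓛 (s ⊔ t) := by
  classical
  intro k f x y h
  have hle1 : s ≤ s ⊔ t := le_sup_left
  have hle2 : t ≤ s ⊔ t := le_sup_right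
  have one : ∀ (z : Fin k → A) (i : Fin k) (a b : A), (s ⊔ t) a b →
      (s ⊔ t) (FirstOrder.Language.Structure.funMap f (Function.update z i a))
        (FirstOrder.Language.Structure.funMap f (Function.update z i b)) := by
    intro z i a b hab
    rw [Setoid.sup_eq_eqvGen] at hab
    have hab' : Relation.EqvGen (fun x y => s x y ∨ t x y) a b := hab
    induction hab' with
    | rel a b h' =>
      rcases h' with h' | h'
      · refine hle1 (hs k f _ _ fun j => ?_)
        by_cases hj : j = i
        · subst hj; simpa using h'
        · simp [hj]
      · refine hle2 (ht k f _ _ fun j => ?_)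
        by_cases hj : j = i
        · subst hj; simpa using h'
        · simp [hj]
    | refl a => exact (s ⊔ t).refl _
    | symm a b h' ih => exact (s ⊔ t).symm (ih h')
    | trans a b c h1 h2 ih1 ih2 => exact (s ⊔ t).trans (ih1 h1) (ih2 h2)
  have key : ∀ S : Finset (Fin k), (s ⊔ t) (FirstOrder.Language.Structure.funMap f x)
      (FirstOrder.Language.Structure.funMap f (S.piecewise y x)) := by
    intro S
    induction S using Finset.induction_on with
    | empty => simp
    | insert i S hi ih =>
      refine (s ⊔ t).trans ih ?_
      have h' := one (S.piecewise y x) i (x i) (y i) (h i)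
      rw [Finset.piecewise_insert]
      have e : Function.update (S.piecewise y x) i (x i) = S.piecewise y x := by
        rw [Function.update_eq_self_iff]; simp [hi]
      rwa [e] at h'
  simpa using key Finset.univ

/-- `Con A`, as a sublattice of the lattice `Setoid A` of all equivalence relations on `A`. -/
def Congruences (𝓛 : FirstOrder.Language.{u, v}) (A : Type w) [𝓛.Structure A] :
    Sublattice (Setoid A) where
  carrier := {s | IsCongruence 𝓛 s}
  supClosed' := fun _ hs _ ht => IsCongruence.sup hs ht
  infClosed' := fun _ hs _ ht => IsCongruence.inf hs ht

/-- The least congruence is equality and the largest one is the total relation. -/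
instance (𝓛 : FirstOrder.Language.{u, v}) (A : Type w) [𝓛.Structure A] :
    BoundedOrder (Congruences 𝓛 A) where
  top := ⟨⊤, fun _ _ _ _ _ => trivial⟩
  le_top := fun s => (le_top : s.1 ≤ ⊤)
  bot := ⟨⊥, fun _ f x y h =>
    congrArg (FirstOrder.Language.Structure.funMap f) (funext h : x = y)⟩
  bot_le := fun s => (bot_le : ⊥ ≤ s.1)

/-- Distributivity of a lattice, as a property. -/
def IsDistributiveLattice (α : Type*) [Lattice α] : Prop :=
  ∀ x y z : α, x ⊓ (y ⊔ z) = (x ⊓ y) ⊔ (x ⊓ z)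

/-- A bounded lattice is boolean if it is distributive and complemented. -/
def IsBooleanLattice (α : Type*) [Lattice α] [BoundedOrder α] : Prop :=
  IsDistributiveLattice α ∧ ∀ x : α, ∃ y : α, IsCompl x y

/-- The algebra `A` is congruence distributive. -/
def IsCongruenceDistributive (𝓛 : FirstOrder.Language.{u, v}) (A : Type w) [𝓛.Structure A] :
    Prop :=
  IsDistributiveLattice (Congruences 𝓛 A)

/-! ### Energy -/

open Classical in
/-- The energy of a finite simple graph: the sum of the absolute values of the eigenvalues of its
adjacency matrix, counted with multiplicity. -/
def graphEnergy {V : Type w} [Fintype V] (G : SimpleGraph V) : ℝ :=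
  ∑ i, |(show (G.adjMatrix ℝ).IsHermitian from G.isSymm_adjMatrix).eigenvalues i|

/-- The graph of an equivalence relation: distinct related elements are joined by an edge. -/
def equivGraph {A : Type w} (s : Setoid A) : SimpleGraph A where
  Adj x y := x ≠ y ∧ s x y
  symm := ⟨fun _ _ h => ⟨h.1.symm, s.symm h.2⟩⟩
  loopless := ⟨fun _ h => h.1 rfl⟩

/-- A finite algebra has finitely many congruences. -/
instance (𝓛 : FirstOrder.Language.{u, v}) (A : Type w) [𝓛.Structure A] [Finite A] :
    Finite (Congruences 𝓛 A) :=
  Finite.of_injective (fun θ : Congruences 𝓛 A => fun x y : A => (θ : Setoid A) x y)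
    fun _ _ h => Subtype.ext (Setoid.ext fun x y => iff_of_eq (congrFun (congrFun h x) y))

/-- The congruence energy `CE(A)` of a finite algebra `A`. -/
def congruenceEnergy (𝓛 : FirstOrder.Language.{u, v}) (A : Type w) [𝓛.Structure A]
    [Fintype A] : ℝ :=
  letI : Fintype (Congruences 𝓛 A) := Fintype.ofFinite _
  ∑ θ : Congruences 𝓛 A, graphEnergy (equivGraph (θ : Setoid A))

/-! ### Lattices as algebras -/

/-- The operation symbols of lattices: binary meet and binary join. -/
inductive LatticeOp : ℕ → Type
  | meet : LatticeOp 2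
  | join : LatticeOp 2

/-- The algebraic language of lattices. -/
def latticeLanguage : FirstOrder.Language.{0, 0} := ⟨LatticeOp, fun _ => Empty⟩

/-- Every lattice is an algebra with its meet and join as the basic operations. -/
instance (L : Type w) [Lattice L] : latticeLanguage.Structure L where
  funMap := fun {k} (f : LatticeOp k) =>
    match k, f with
    | _, .meet => fun x => x 0 ⊓ x 1
    | _, .join => fun x => x 0 ⊔ x 1
  RelMap := fun r _ => nomatch r

/-- The congruence energy of a finite lattice. -/
def latticeCE (L : Type w) [Lattice L] [Fintype L] : ℝ := congruenceEnergy latticeLanguage L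

/-- A lattice is a chain if any two of its elements are comparable. -/
def IsChainLattice (L : Type w) [Lattice L] : Prop := ∀ x y : L, x ≤ y ∨ y ≤ x

/-- The glued sum of `U` and `V`: the disjoint union of `U` and `V ∖ {0}`, ordered
with every element of `U` below every element of `V ∖ {0}` (`⊕ₗ` is the lexicographic sum). -/
abbrev GluedSum (U : Type*) (V : Type*) [PartialOrder U] [PartialOrder V] [OrderBot V] : Type _ :=
  U ⊕ₗ {x : V // x ≠ ⊥}

/-- The four-element boolean lattice. -/
abbrev B4 : Type := Bool × Bool

/-- `L` is, up to isomorphism, the glued sum `(C' ∔ B₄) ∔ C''` for some finite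
(nonempty) chains `C'` and `C''`. -/
def IsChainB4ChainSum (L : Type w) [Lattice L] : Prop :=
  ∃ (C' C'' : Type w) (_ : LinearOrder C') (_ : LinearOrder C'') (_ : OrderBot C''),
    Finite C' ∧ Nonempty C' ∧ Finite C'' ∧
      Nonempty (L ≃o GluedSum (GluedSum C' B4) C'')

end

/-! ### Energy of the graph of an equivalence relation -/

section Energy
open Matrix

/-! The graph of an equivalence relation is a disjoint union of complete graphs, so its energy is
twice the number of elements minus twice the number of classes (`graphEnergy_equivGraph`).
Everything reduces to bounding the sum of `|A| - |A/θ|` over all congruences. The method is to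
encode each congruence injectively as a subset of a set `J` of size `r`, bound its term by the size
of that subset plus a constant `d` with `r + d = n - 1`, and compare with the sum over all subsets
of `J`.

For (a), `J` is the set of sup-irreducibles of the distributive lattice `Con A`, and long chains in
`Con A` force the term bound (`card_supIrreds_lt_of_strictAnti`). Equality forces `d = 0` and every
subset to occur.

For lattices, `J` is the set of sup-irreducibles of `L` itself and `d` counts the joins of
incomparable pairs. A congruence is determined by the irreducibles it collapses
(`collapsed_injective`), and `|L| - |L/θ|` counts the elements that are not least in their class.
Chains are the case `d = 0`. For `d ≥ 2` the bound is already below the second value. For `d = 1`,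
either there is a single incomparable pair, every subset occurs and the sum is computed exactly, or
collapsing one irreducible forces collapsing another (`exists_collapsed_implication`), which
excludes a quarter of the subsets. -/

theorem equivGraph_adj {A : Type*} (s : Setoid A) (x y : A) :
    (equivGraph s).Adj x y ↔ x ≠ y ∧ s x y := Iff.rfl

open Classical in
-- Used to count the eigenvalues different from -1: diagonalizing `A` also diagonalizes `A + 1`.
theorem Matrix.IsHermitian.rank_add_one {V : Type*} [Fintype V] {A : Matrix V V ℝ}
    (hA : A.IsHermitian) :
    (A + 1).rank = Fintype.card {i // hA.eigenvalues i + 1 ≠ 0} := by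
  have h : A + 1 = Unitary.conjStarAlgAut ℝ _ hA.eigenvectorUnitary
      (diagonal fun i => hA.eigenvalues i + 1) := by
    have h1 : (diagonal fun i => hA.eigenvalues i + 1)
        = diagonal (RCLike.ofReal ∘ hA.eigenvalues : V → ℝ) + 1 := by
      rw [← diagonal_one, diagonal_add]
      rfl
    rw [h1, map_add, map_one, ← hA.spectral_theorem]
  have h2 : (A + 1).rank = (diagonal fun i => hA.eigenvalues i + 1).rank := by
    conv_lhs => rw [h, Unitary.conjStarAlgAut_apply, ← Unitary.coe_star]
    simp [-isUnit_iff_ne_zero, -Unitary.coe_star, rank_diagonal]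
  rw [h2, rank_diagonal]

open Classical in
-- The matrix factors as `M * Mᵀ` with `M` the incidence matrix of elements against classes. Picking
-- one row per class gives an identity submatrix, so `M` has full column rank.
theorem rank_equivGraph_adjMatrix_add_one {A : Type w} [Fintype A] (s : Setoid A) :
    ((equivGraph s).adjMatrix ℝ + 1).rank = Nat.card (Quotient s) := by
  obtain ⟨M, hMdef⟩ : ∃ M : Matrix A (Quotient s) ℝ,
      ∀ x q, M x q = if Quotient.mk s x = q then 1 else 0 := ⟨Matrix.of _, fun _ _ => rfl⟩
  have hM : (equivGraph s).adjMatrix ℝ + 1 = M * Mᵀ := by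
    ext x y
    simp only [Matrix.add_apply, SimpleGraph.adjMatrix_apply, Matrix.one_apply, Matrix.mul_apply,
      hMdef, Matrix.transpose_apply, equivGraph_adj]
    simp only [ite_mul, one_mul, zero_mul, Finset.sum_ite_eq, Finset.mem_univ, if_true]
    by_cases hxy : x = y
    · subst hxy; simp
    · have : Quotient.mk s y = Quotient.mk s x ↔ s x y :=
        Quotient.eq.trans ⟨s.symm, s.symm⟩
      simp [hxy, this]
  rw [hM, rank_self_mul_transpose, Nat.card_eq_fintype_card]
  refine le_antisymm (rank_le_card_width _) ?_
  have hsub : M.submatrix Quotient.out id = (1 : Matrix (Quotient s) (Quotient s) ℝ) := by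
    ext p q
    simp [hMdef, Matrix.one_apply]
  calc Fintype.card (Quotient s) = (M.submatrix Quotient.out id).rank := by rw [hsub, rank_one]
    _ ≤ M.rank := rank_submatrix_le _ _ _

open Classical in
-- Adding `f y` to both sides turns the eigenvalue equation at `y` into: `(μ + 1) * f y` is the sum
-- of `f` over the class of `y`. If `μ ≠ -1`, then `f` is constant on classes, and where `f` is
-- nonzero `μ + 1` is a class size.
theorem eigenvalue_equivGraph {A : Type w} [Fintype A] (s : Setoid A) {μ : ℝ} {f : A → ℝ}
    (hf : f ≠ 0) (h : (equivGraph s).adjMatrix ℝ *ᵥ f = μ • f) : μ = -1 ∨ 0 ≤ μ := by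
  by_contra! hμ
  obtain ⟨x, hx⟩ := Function.ne_iff.1 hf
  have key : ∀ y, (μ + 1) * f y = ∑ z with s y z, f z := by
    intro y
    have h1 := congrFun h y
    rw [SimpleGraph.adjMatrix_mulVec_apply] at h1
    have h2 : Finset.univ.filter (s y) = insert y ((equivGraph s).neighborFinset y) := by
      ext z
      simp only [Finset.mem_filter, Finset.mem_univ, true_and, Finset.mem_insert,
        SimpleGraph.mem_neighborFinset, equivGraph_adj]
      by_cases hz : z = y
      · subst hz; simp
      · simp [hz, Ne.symm hz]
    rw [h2, Finset.sum_insert (by simp), h1]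
    simp only [Pi.smul_apply, smul_eq_mul]
    ring
  have hμ1 : μ + 1 ≠ 0 := fun h0 => hμ.1 (by linarith)
  have hconst : ∀ z, s x z → f z = f x := by
    intro z hz
    apply mul_left_cancel₀ hμ1
    rw [key, key]
    congr 1
    ext t
    simp only [Finset.mem_filter, Finset.mem_univ, true_and]
    exact ⟨s.trans hz, s.trans (s.symm hz)⟩
  have h3 := key x
  rw [Finset.sum_congr rfl (fun z hz => hconst z (Finset.mem_filter.1 hz).2), Finset.sum_const,
    nsmul_eq_mul] at h3
  have h4 := mul_right_cancel₀ hx h3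
  have h5 : 1 ≤ (Finset.univ.filter (s x)).card :=
    Finset.card_pos.2 ⟨x, by simp⟩
  have h6 : (1 : ℝ) ≤ ((Finset.univ.filter (s x)).card : ℝ) := by exact_mod_cast h5
  linarith [hμ.2]

theorem graphEnergy_equivGraph {A : Type w} [Fintype A] (s : Setoid A) :
    graphEnergy (equivGraph s) = 2 * ((Fintype.card A : ℝ) - Nat.card (Quotient s)) := by
  classical
  unfold graphEnergy
  have hA : ((equivGraph s).adjMatrix ℝ).IsHermitian := (equivGraph s).isSymm_adjMatrix
  change ∑ i, |hA.eigenvalues i| = _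
  -- Only the eigenvalue -1 is negative, so `|λ|` exceeds `λ` by 2 there and by 0 elsewhere. As the
  -- trace vanishes, only the count of eigenvalues -1 remains.
  have habs : ∀ i, |hA.eigenvalues i|
      = hA.eigenvalues i + 2 * (1 - if hA.eigenvalues i + 1 ≠ 0 then 1 else 0) := by
    intro i
    have hne : (⇑(hA.eigenvectorBasis i) : A → ℝ) ≠ 0 := by
      intro h0
      apply hA.eigenvectorBasis.orthonormal.ne_zero i
      ext x
      exact congrFun h0 x
    rcases eigenvalue_equivGraph s hne (hA.mulVec_eigenvectorBasis i) with h | h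
    · rw [h]; norm_num
    · rw [abs_of_nonneg h, if_pos (by linarith)]; ring
  rw [Finset.sum_congr rfl fun i _ => habs i, Finset.sum_add_distrib, ← Finset.mul_sum,
    Finset.sum_sub_distrib]
  have htr : ∑ i, hA.eigenvalues i = 0 := by
    have := hA.trace_eq_sum_eigenvalues
    simpa using this.symm
  have hrank := hA.rank_add_one
  rw [rank_equivGraph_adjMatrix_add_one, Fintype.card_subtype] at hrank
  rw [htr, Finset.sum_boole, hrank]
  simp

end Energy

theorem congruenceEnergy_eq (𝓛 : FirstOrder.Language.{u, v}) (A : Type w) [𝓛.Structure A]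
    [Fintype A] [Fintype (Congruences 𝓛 A)] :
    congruenceEnergy 𝓛 A = ((2 * ∑ θ : Congruences 𝓛 A,
      (Fintype.card A - Nat.card (Quotient (θ : Setoid A))) : ℕ) : ℝ) := by
  unfold congruenceEnergy
  push_cast
  rw [Finset.mul_sum]
  refine Finset.sum_congr (by congr!) fun θ _ => ?_
  rw [graphEnergy_equivGraph, Nat.cast_sub]
  rw [Nat.card_eq_fintype_card.symm]
  exact Nat.card_le_card_of_surjective _ (Quotient.mk_surjective (s := (θ : Setoid A)))

/-! ### Weighted sums over families of subsets -/

section PowersetSums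
open Finset

/-- Pair each subset with its complement. -/
theorem Finset.two_mul_sum_powerset_card {β : Type*} (J : Finset β) :
    2 * ∑ X ∈ J.powerset, X.card = 2 ^ J.card * J.card := by
  classical
  have h : ∑ X ∈ J.powerset, X.card = ∑ X ∈ J.powerset, (J \ X).card := by
    refine Finset.sum_nbij' (fun X => J \ X) (fun X => J \ X) ?_ ?_ ?_ ?_ ?_ <;>
      simp +contextual
  calc 2 * ∑ X ∈ J.powerset, X.card
      = ∑ X ∈ J.powerset, (X.card + (J \ X).card) := by
        rw [sum_add_distrib, ← h, two_mul]
    _ = ∑ X ∈ J.powerset, J.card := by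
        refine sum_congr rfl fun X hX => ?_
        have := card_sdiff_add_card_eq_card (mem_powerset.1 hX)
        omega
    _ = 2 ^ J.card * J.card := by rw [sum_const, card_powerset, smul_eq_mul]

theorem Finset.two_mul_sum_powerset_card_add {β : Type*} (J : Finset β) (d : ℕ) :
    2 * ∑ X ∈ J.powerset, (X.card + d) = 2 ^ J.card * (J.card + 2 * d) := by
  rw [sum_add_distrib, mul_add, two_mul_sum_powerset_card, sum_const, card_powerset, smul_eq_mul]
  ring

variable {ι β : Type*} [Fintype ι]

theorem two_mul_sum_le_of_injective_powerset {J : Finset β} {φ : ι → Finset β}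
    (hφ : Function.Injective φ) (hJ : ∀ i, φ i ⊆ J) {f : ι → ℕ} {d : ℕ}
    (hf : ∀ i, f i ≤ (φ i).card + d) :
    2 * ∑ i, f i ≤ 2 ^ J.card * (J.card + 2 * d) := by
  classical
  rw [← two_mul_sum_powerset_card_add]
  refine Nat.mul_le_mul_left _ ?_
  calc ∑ i, f i ≤ ∑ i, ((φ i).card + d) := sum_le_sum fun i _ => hf i
    _ = ∑ X ∈ univ.image φ, (X.card + d) := by rw [sum_image fun _ _ _ _ h => hφ h]
    _ ≤ ∑ X ∈ J.powerset, (X.card + d) := sum_le_sum_of_subset (by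
        intro X hX
        obtain ⟨i, -, rfl⟩ := mem_image.1 hX
        exact mem_powerset.2 (hJ i))

theorem Finset.card_filter_powerset_notMem_notMem {β : Type*} [DecidableEq β] {J : Finset β}
    {p q : β} (hp : p ∈ J) (hq : q ∈ J) (hpq : p ≠ q) :
    4 * (J.powerset.filter fun X => p ∉ X ∧ q ∉ X).card = 2 ^ J.card := by
  have h : J.powerset.filter (fun X => p ∉ X ∧ q ∉ X) = ((J.erase p).erase q).powerset := by
    ext X
    simp only [mem_filter, mem_powerset, subset_erase]
    tauto
  have hq' : q ∈ J.erase p := mem_erase.2 ⟨hpq.symm, hq⟩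
  have h1 := card_erase_add_one hp
  have h2 := card_erase_add_one hq'
  rw [h, card_powerset, ← h1, ← h2]
  ring

theorem Finset.card_filter_powerset_mem_notMem {β : Type*} [DecidableEq β] {J : Finset β}
    {p q : β} (hp : p ∈ J) (hq : q ∈ J) (hpq : p ≠ q) :
    4 * (J.powerset.filter fun X => p ∈ X ∧ q ∉ X).card = 2 ^ J.card := by
  rw [← card_filter_powerset_notMem_notMem hp hq hpq]
  congr 1
  refine Finset.card_nbij' (fun X => X.erase p) (fun X => insert p X) ?_ ?_ ?_ ?_
  · intro X hX
    simp only [coe_filter, mem_powerset, Set.mem_ofPred_eq] at hX ⊢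
    exact ⟨(erase_subset _ _).trans hX.1, by simp, fun h => hX.2.2 (mem_of_mem_erase h)⟩
  · intro X hX
    simp only [coe_filter, mem_powerset, Set.mem_ofPred_eq] at hX ⊢
    refine ⟨insert_subset hp hX.1, by simp, ?_⟩
    simp [hX.2.2, hpq.symm]
  · intro X hX
    simp only [coe_filter, mem_powerset, Set.mem_ofPred_eq] at hX
    exact insert_erase hX.2.1
  · intro X hX
    simp only [coe_filter, mem_powerset, Set.mem_ofPred_eq] at hX
    exact erase_insert hX.2.1

/-- If membership of `p` forces membership of `q`, a quarter of the subsets of `J` is missed. -/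
theorem two_mul_sum_lt_of_implication {J : Finset β} {φ : ι → Finset β}
    (hφ : Function.Injective φ) (hJ : ∀ i, φ i ⊆ J) {f : ι → ℕ}
    (hf : ∀ i, f i ≤ (φ i).card + 1) {p q : β} (hp : p ∈ J) (hq : q ∈ J) (hpq : p ≠ q)
    (himp : ∀ i, p ∈ φ i → q ∈ φ i) :
    2 * ∑ i, f i + 2 ^ J.card ≤ 2 ^ J.card * (J.card + 2) := by
  classical
  have key := two_mul_sum_powerset_card_add J 1
  rw [mul_one] at key
  rw [← key, ← card_filter_powerset_mem_notMem hp hq hpq]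
  set E := J.powerset.filter fun X => p ∈ X ∧ q ∉ X with hE
  -- Each missed subset contains `p`, so it weighs at least 2. A quarter of the powerset is missed,
  -- which after doubling costs `2 ^ J.card`.
  have h1 : E.card * 2 ≤ ∑ X ∈ E, (X.card + 1) := by
    rw [← smul_eq_mul]
    refine card_nsmul_le_sum _ _ _ fun X hX => ?_
    have : 0 < X.card := card_pos.2 ⟨p, (mem_filter.1 hX).2.1⟩
    omega
  have h2 : ∑ i, f i ≤ ∑ X ∈ univ.image φ, (X.card + 1) := by
    rw [sum_image fun _ _ _ _ h => hφ h]
    exact sum_le_sum fun i _ => hf i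
  have hdisj : Disjoint (univ.image φ) E := by
    rw [disjoint_left]
    intro X hX hXE
    obtain ⟨i, -, rfl⟩ := mem_image.1 hX
    exact (mem_filter.1 hXE).2.2 (himp i (mem_filter.1 hXE).2.1)
  have h3 : ∑ X ∈ univ.image φ, (X.card + 1) + ∑ X ∈ E, (X.card + 1)
      ≤ ∑ X ∈ J.powerset, (X.card + 1) := by
    rw [← sum_union hdisj]
    refine sum_le_sum_of_subset (union_subset ?_ (filter_subset _ _))
    intro X hX
    obtain ⟨i, -, rfl⟩ := mem_image.1 hX
    exact mem_powerset.2 (hJ i)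
  omega

theorem sum_eq_sum_powerset {J : Finset β} {φ : ι → Finset β}
    (hφ : Function.Injective φ) (hJ : ∀ i, φ i ⊆ J) (hsurj : ∀ X ⊆ J, ∃ i, φ i = X)
    (g : Finset β → ℕ) : ∑ i, g (φ i) = ∑ X ∈ J.powerset, g X :=
  Finset.sum_nbij φ (fun i _ => mem_powerset.2 (hJ i)) (fun _ _ _ _ h => hφ h)
    (fun X hX => by
      obtain ⟨i, hi⟩ := hsurj X (mem_powerset.1 hX)
      exact ⟨i, by simp, hi⟩) fun _ _ => rfl

/-- Compared with adding 1 to every subset, the loss is one for each subset avoiding both `a` and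
`b`, a quarter of them all. -/
theorem two_mul_sum_powerset_card_add_ite [DecidableEq β] {J : Finset β} {a b : β}
    (ha : a ∈ J) (hb : b ∈ J) (hab : a ≠ b) :
    4 * ∑ X ∈ J.powerset, (X.card + if a ∈ X ∨ b ∈ X then 1 else 0) =
      2 ^ J.card * (2 * J.card + 3) := by
  have key := two_mul_sum_powerset_card_add J 1
  have h : ∑ X ∈ J.powerset, (X.card + if a ∈ X ∨ b ∈ X then 1 else 0)
      + (J.powerset.filter fun X => a ∉ X ∧ b ∉ X).card = ∑ X ∈ J.powerset, (X.card + 1) := by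
    rw [card_filter, ← sum_add_distrib]
    refine sum_congr rfl fun X _ => ?_
    by_cases h1 : a ∈ X <;> by_cases h2 : b ∈ X <;> simp [h1, h2]
  have h4 := card_filter_powerset_notMem_notMem ha hb hab
  have : 2 ^ J.card * (2 * J.card + 3) + 2 ^ J.card = 2 * (2 ^ J.card * (J.card + 2 * 1)) := by
    ring
  omega

theorem two_pow_mul_le (r d : ℕ) : 2 ^ r * (r + 2 * d) ≤ (r + d) * 2 ^ (r + d) := by
  have h : d + 1 ≤ 2 ^ d := Nat.lt_two_pow_self
  calc 2 ^ r * (r + 2 * d) ≤ 2 ^ r * ((r + d) * (d + 1)) := by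
        refine Nat.mul_le_mul_left _ ?_
        nlinarith [Nat.le_self_pow two_ne_zero d, Nat.zero_le (r * d)]
    _ ≤ 2 ^ r * ((r + d) * 2 ^ d) := by gcongr
    _ = _ := by rw [pow_add]; ring

theorem two_pow_mul_lt {r d : ℕ} (hd : 1 ≤ d) (hrd : 2 ≤ r + d) :
    2 ^ r * (r + 2 * d) < (r + d) * 2 ^ (r + d) := by
  have h : d + 1 ≤ 2 ^ d := Nat.lt_two_pow_self
  calc 2 ^ r * (r + 2 * d) < 2 ^ r * ((r + d) * (d + 1)) := by
        refine Nat.mul_lt_mul_of_pos_left ?_ (by positivity)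
        nlinarith
    _ ≤ 2 ^ r * ((r + d) * 2 ^ d) := by gcongr
    _ = _ := by rw [pow_add]; ring

/-- With `d = 2 + e`, cancel `4 * 2 ^ r` and use `e + 1 ≤ 2 ^ e`; for `e = 0` what remains is `r + 4
< 2 * r + 5`. -/
theorem four_mul_two_pow_mul_lt {r d : ℕ} (hd : 2 ≤ d) :
    4 * (2 ^ r * (r + 2 * d)) < 2 ^ (r + d) * (2 * (r + d) + 1) := by
  obtain ⟨e, rfl⟩ := Nat.exists_eq_add_of_le hd
  have h : e + 1 ≤ 2 ^ e := Nat.lt_two_pow_self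
  calc 4 * (2 ^ r * (r + 2 * (2 + e))) = 4 * 2 ^ r * (r + 2 * (2 + e)) := by ring
    _ < 4 * 2 ^ r * ((e + 1) * (2 * (r + (2 + e)) + 1)) := by
        refine Nat.mul_lt_mul_of_pos_left ?_ (by positivity)
        nlinarith [Nat.zero_le (e * r), Nat.zero_le (e * e)]
    _ ≤ 4 * 2 ^ r * (2 ^ e * (2 * (r + (2 + e)) + 1)) := by gcongr
    _ = _ := by rw [pow_add, pow_add]; ring

end PowersetSums

/-! ### Counting in finite distributive lattices -/

section DistributiveLattices
open Finset Classical

theorem SupIrred.le_or_le_of_isDistributiveLattice {D : Type*} [Lattice D]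
    (hD : IsDistributiveLattice D) {j x y : D}
    (hj : SupIrred j) (h : j ≤ x ⊔ y) : j ≤ x ∨ j ≤ y := by
  have h1 : (j ⊓ x) ⊔ (j ⊓ y) = j := by rw [← hD, inf_eq_left.2 h]
  exact (hj.2 h1).imp inf_eq_left.1 inf_eq_left.1

/-- The sup-irreducible elements of a finite lattice. -/
noncomputable def supIrreds (D : Type*) [Lattice D] [Fintype D] : Finset D := univ.filter SupIrred

theorem mem_supIrreds {D : Type*} [Lattice D] [Fintype D] {j : D} :
    j ∈ supIrreds D ↔ SupIrred j := by simp [supIrreds]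

/-- The sup-irreducible elements below a given element. -/
noncomputable def supIrredsBelow {D : Type*} [Lattice D] [Fintype D] (x : D) : Finset D :=
  (supIrreds D).filter (· ≤ x)

variable {D : Type*} [Lattice D] [Fintype D]

theorem mem_supIrredsBelow {j x : D} : j ∈ supIrredsBelow x ↔ SupIrred j ∧ j ≤ x := by
  simp [supIrredsBelow, mem_supIrreds]

theorem supIrredsBelow_subset (x : D) : supIrredsBelow x ⊆ supIrreds D := filter_subset _ _

/-- In a finite distributive lattice, there is a chain from `x` to the top element whose length is
the number of sup-irreducible elements that are not below `x`. -/
theorem card_supIrreds_lt_of_strictAnti (hD : IsDistributiveLattice D) {c : D → ℕ}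
    (hc : StrictAnti c) (hpos : ∀ x, 0 < c x) (x : D) :
    (supIrreds D).card < c x + (supIrredsBelow x).card := by
  induction x using (wellFounded_gt (α := D)).induction with
  | _ x ih =>
  by_cases hx : supIrredsBelow x = supIrreds D
  · have := hpos x
    rw [hx]; omega
  · have hne : (supIrreds D \ supIrredsBelow x).Nonempty := by
      rw [nonempty_iff_ne_empty, Ne, sdiff_eq_empty_iff_subset]
      exact fun h => hx ((supIrredsBelow_subset x).antisymm h)
    -- Minimality of `j` and join-primeness of irreducibles ensure that passing from `x` to `x ⊔ j`
    -- adds no irreducible other than `j`, while `c` drops by at least one.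
    obtain ⟨j, hj⟩ := exists_minimal hne
    have hjJ : SupIrred j := mem_supIrreds.1 (mem_sdiff.1 hj.1).1
    have hjx : ¬ j ≤ x := fun h => (mem_sdiff.1 hj.1).2 (mem_supIrredsBelow.2 ⟨hjJ, h⟩)
    have hlt : x < x ⊔ j := left_lt_sup.2 hjx
    have hsub : supIrredsBelow (x ⊔ j) ⊆ insert j (supIrredsBelow x) := by
      intro i hi
      obtain ⟨hi1, hi2⟩ := mem_supIrredsBelow.1 hi
      rw [mem_insert, mem_supIrredsBelow]
      rcases hi1.le_or_le_of_isDistributiveLattice hD hi2 with h | h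
      · exact Or.inr ⟨hi1, h⟩
      · by_cases hix : i ≤ x
        · exact Or.inr ⟨hi1, hix⟩
        · left
          exact h.antisymm (hj.2 (mem_sdiff.2 ⟨mem_supIrreds.2 hi1,
            fun h' => hix (mem_supIrredsBelow.1 h').2⟩) h)
    have h1 := (card_le_card hsub).trans (card_insert_le _ _)
    have h2 := ih (x ⊔ j) hlt
    have h3 := hc hlt
    omega

variable [BoundedOrder D]

theorem le_of_supIrredsBelow_subset {x y : D} (h : supIrredsBelow x ⊆ supIrredsBelow y) :
    x ≤ y := by
  obtain ⟨s, rfl, hs⟩ := exists_supIrred_decomposition x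
  exact Finset.sup_le fun b hb =>
    (mem_supIrredsBelow.1 (h (mem_supIrredsBelow.2 ⟨hs hb, Finset.le_sup (f := id) hb⟩))).2

theorem supIrredsBelow_injective : Function.Injective (supIrredsBelow (D := D)) :=
  fun _ _ h => le_antisymm (le_of_supIrredsBelow_subset h.subset)
    (le_of_supIrredsBelow_subset h.superset)

theorem supIrredsBelow_bot : supIrredsBelow (⊥ : D) = ∅ := by
  ext j
  simp only [mem_supIrredsBelow, le_bot_iff, notMem_empty, iff_false]
  exact fun h => h.1.ne_bot h.2

theorem supIrredsBelow_top : supIrredsBelow (⊤ : D) = supIrreds D := by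
  ext j
  simp [mem_supIrredsBelow, mem_supIrreds]

/-- The chain bound at `⊥` gives at most `m` sup-irreducibles; with `d` the deficit, it bounds each
term by `(supIrredsBelow x).card + d`. In case of equality `d = 0` and every set of irreducibles is
some `supIrredsBelow x`, so complements come from set complements. -/
theorem two_mul_sum_le_of_strictAnti (hD : IsDistributiveLattice D) {c : D → ℕ}
    (hc : StrictAnti c) (hpos : ∀ x, 0 < c x) {m : ℕ} (hbot : c ⊥ = m + 1) :
    2 * ∑ x, (m + 1 - c x) ≤ m * 2 ^ m ∧
      (2 * ∑ x, (m + 1 - c x) = m * 2 ^ m → IsBooleanLattice D ∧ Fintype.card D = 2 ^ m) := by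
  have hchain := card_supIrreds_lt_of_strictAnti hD hc hpos
  have hr : (supIrreds D).card ≤ m := by
    have := hchain ⊥
    rw [supIrredsBelow_bot, hbot, card_empty] at this
    omega
  obtain ⟨d, rfl⟩ := Nat.exists_eq_add_of_le hr
  have hbound := two_mul_sum_le_of_injective_powerset (supIrredsBelow_injective (D := D))
    supIrredsBelow_subset (f := fun x => (supIrreds D).card + d + 1 - c x) (d := d) (by
      intro x
      have := hchain x
      omega)
  refine ⟨hbound.trans (two_pow_mul_le _ _), fun heq => ?_⟩
  rw [heq] at hbound
  have hd : d = 0 := by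
    by_contra hd
    -- The strict inequality fails for `r = 0`, `d = 1`. There `D` is trivial, so the sum is 0 and
    -- cannot equal the positive bound.
    rcases Nat.lt_or_ge ((supIrreds D).card + d) 2 with h | h
    · have h0 : (supIrreds D).card = 0 := by omega
      have hbt : (⊤ : D) = ⊥ := supIrredsBelow_injective (by
        rw [supIrredsBelow_bot, supIrredsBelow_top, card_eq_zero.1 h0])
      have hall : ∀ x : D, x = ⊥ := fun x => le_bot_iff.1 (hbt ▸ le_top)
      have hz : ∑ x, ((supIrreds D).card + d + 1 - c x) = 0 :=
        sum_eq_zero fun x _ => by rw [hall x, hbot]; omega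
      rw [hz, h0] at heq
      have : 0 < (0 + d) * 2 ^ (0 + d) := by
        have : 0 < d := by omega
        positivity
      omega
    · exact absurd hbound (two_pow_mul_lt (by omega) h).not_ge
  subst hd
  have himage : univ.image (supIrredsBelow (D := D)) = (supIrreds D).powerset := by
    have hsub : univ.image (supIrredsBelow (D := D)) ⊆ (supIrreds D).powerset := by
      intro X hX
      obtain ⟨x, -, rfl⟩ := mem_image.1 hX
      exact mem_powerset.2 (supIrredsBelow_subset x)
    by_contra hne
    have hss := hsub.ssubset_of_ne hne
    obtain ⟨X, hX, hXn⟩ := exists_of_ssubset hss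
    -- The empty set is attained at `⊥`, so any missed subset has positive weight and would make the
    -- inequality strict.
    have hXpos : 0 < X.card := by
      rw [card_pos, nonempty_iff_ne_empty]
      rintro rfl
      exact hXn (mem_image.2 ⟨⊥, mem_univ _, supIrredsBelow_bot⟩)
    have hlt : ∑ X ∈ univ.image (supIrredsBelow (D := D)), X.card
        < ∑ X ∈ (supIrreds D).powerset, X.card :=
      sum_lt_sum_of_subset hsub hX hXn hXpos fun _ _ _ => Nat.zero_le _
    rw [sum_image fun _ _ _ _ h => supIrredsBelow_injective h] at hlt
    have hle : ∑ x, ((supIrreds D).card + 0 + 1 - c x) ≤ ∑ x : D, (supIrredsBelow x).card :=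
      sum_le_sum fun x _ => by have := hchain x; omega
    have h2 := two_mul_sum_powerset_card (supIrreds D)
    rw [add_zero, mul_comm] at heq
    rw [mul_comm] at heq
    simp only [add_zero] at hle
    rw [mul_comm (2 ^ _)] at h2
    omega
  have hsurj : ∀ X ⊆ supIrreds D, ∃ x : D, supIrredsBelow x = X := by
    intro X hX
    have := himage.superset (mem_powerset.2 hX)
    obtain ⟨x, -, hx⟩ := mem_image.1 this
    exact ⟨x, hx⟩
  refine ⟨⟨hD, fun x => ?_⟩, ?_⟩
  · obtain ⟨y, hy⟩ := hsurj (supIrreds D \ supIrredsBelow x) sdiff_subset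
    refine ⟨y, isCompl_iff.2 ⟨disjoint_iff.2 (supIrredsBelow_injective ?_),
      codisjoint_iff.2 (supIrredsBelow_injective ?_)⟩⟩
    · rw [supIrredsBelow_bot]
      ext j
      simp only [mem_supIrredsBelow, notMem_empty, iff_false, le_inf_iff]
      rintro ⟨h1, h2, h3⟩
      have hjy : j ∈ supIrredsBelow y := mem_supIrredsBelow.2 ⟨h1, h3⟩
      rw [hy] at hjy
      exact (mem_sdiff.1 hjy).2 (mem_supIrredsBelow.2 ⟨h1, h2⟩)
    · rw [supIrredsBelow_top]
      refine (supIrredsBelow_subset _).antisymm fun j hj => ?_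
      have hjJ := mem_supIrreds.1 hj
      refine mem_supIrredsBelow.2 ⟨hjJ, ?_⟩
      by_cases hjx : j ≤ x
      · exact hjx.trans le_sup_left
      · have hjy : j ∈ supIrredsBelow y := by
          rw [hy]
          exact mem_sdiff.2 ⟨hj, fun h => hjx (mem_supIrredsBelow.1 h).2⟩
        exact (mem_supIrredsBelow.1 hjy).2.trans le_sup_right
  · have := congrArg card himage
    rw [card_image_of_injective _ supIrredsBelow_injective, card_powerset] at this
    simpa using this

end DistributiveLattices

/-! ### Congruence distributive algebras -/

section Algebras

theorem Setoid.card_quotient_lt {A : Type*} [Finite A] {s t : Setoid A} (h : s < t) :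
    Nat.card (Quotient t) < Nat.card (Quotient s) := by
  classical
  have := Fintype.ofFinite A
  rw [Nat.card_eq_fintype_card, Nat.card_eq_fintype_card]
  let g : Quotient s → Quotient t := Quotient.map' id fun a b hab => h.le hab
  have hg : Function.Surjective g := by
    intro q
    induction q using Quotient.inductionOn with
    | _ a => exact ⟨Quotient.mk s a, rfl⟩
  refine Fintype.card_lt_of_surjective_not_injective g hg fun hinj => h.not_ge fun a b hab => ?_
  have : g (Quotient.mk s a) = g (Quotient.mk s b) := Quotient.sound hab
  exact Quotient.exact (hinj this)

theorem Setoid.card_quotient_bot (A : Type*) : Nat.card (Quotient (⊥ : Setoid A)) = Nat.card A :=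
  (Nat.card_congr (Equiv.ofBijective (Quotient.mk (⊥ : Setoid A))
    ⟨fun _ _ h => Quotient.exact h, Quotient.mk_surjective⟩)).symm

theorem congruenceEnergy_le_of_isCongruenceDistributive (𝓛 : FirstOrder.Language.{u, v})
    (A : Type w) [𝓛.Structure A] [Fintype A] {m : ℕ} (hm : Fintype.card A = m + 1)
    (hA : IsCongruenceDistributive 𝓛 A) :
    congruenceEnergy 𝓛 A ≤ ((m * 2 ^ m : ℕ) : ℝ) ∧
      (congruenceEnergy 𝓛 A = ((m * 2 ^ m : ℕ) : ℝ) →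
        IsBooleanLattice (Congruences 𝓛 A) ∧ Nat.card (Congruences 𝓛 A) = 2 ^ m) := by
  classical
  have := Fintype.ofFinite (Congruences 𝓛 A)
  have hne : Nonempty A := Fintype.card_pos_iff.1 (by omega)
  rw [congruenceEnergy_eq, Nat.cast_le, Nat.cast_inj, Nat.card_eq_fintype_card, hm]
  refine two_mul_sum_le_of_strictAnti (D := Congruences 𝓛 A)
    (c := fun θ => Nat.card (Quotient (θ : Setoid A))) hA
    (fun s t h => Setoid.card_quotient_lt h) (fun θ => ?_) ?_
  · have : Nonempty (Quotient (θ : Setoid A)) := ⟨Quotient.mk _ (Classical.arbitrary A)⟩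
    exact Nat.card_pos
  · rw [← hm, ← Nat.card_eq_fintype_card]
    exact Setoid.card_quotient_bot A

end Algebras

/-! ### Lattice congruences and collapsed irreducibles -/

section LatticeCongruences
open Finset Classical

theorem isCongruence_latticeLanguage_iff {L : Type*} [Lattice L] {s : Setoid L} :
    IsCongruence latticeLanguage s ↔
      (∀ a b c d, s a b → s c d → s (a ⊓ c) (b ⊓ d)) ∧
        ∀ a b c d, s a b → s c d → s (a ⊔ c) (b ⊔ d) := by
  constructor
  · intro h
    refine ⟨fun a b c d hab hcd => ?_, fun a b c d hab hcd => ?_⟩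
    · refine h 2 LatticeOp.meet ![a, c] ![b, d] fun i => ?_
      fin_cases i
      exacts [hab, hcd]
    · refine h 2 LatticeOp.join ![a, c] ![b, d] fun i => ?_
      fin_cases i
      exacts [hab, hcd]
  · rintro ⟨h1, h2⟩ k f x y hxy
    cases f with
    | meet => exact h1 _ _ _ _ (hxy 0) (hxy 1)
    | join => exact h2 _ _ _ _ (hxy 0) (hxy 1)

section
variable {L : Type*} [Lattice L] (θ : Congruences latticeLanguage L)

theorem Congruences.inf_right {a b : L} (h : θ.1 a b) (c : L) : θ.1 (a ⊓ c) (b ⊓ c) :=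
  (isCongruence_latticeLanguage_iff.1 θ.2).1 _ _ _ _ h (θ.1.refl c)

theorem Congruences.sup_right {a b : L} (h : θ.1 a b) (c : L) : θ.1 (a ⊔ c) (b ⊔ c) :=
  (isCongruence_latticeLanguage_iff.1 θ.2).2 _ _ _ _ h (θ.1.refl c)

theorem Congruences.sup_sup {a b c d : L} (h : θ.1 a b) (h' : θ.1 c d) :
    θ.1 (a ⊔ c) (b ⊔ d) :=
  (isCongruence_latticeLanguage_iff.1 θ.2).2 _ _ _ _ h h'

/-- The elements that are not the least element of their congruence class. -/
noncomputable def nonleast [Fintype L] : Finset L := univ.filter fun x => ∃ y < x, θ.1 y x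

variable {θ} [Fintype L]

theorem mem_nonleast {x : L} : x ∈ nonleast θ ↔ ∃ y < x, θ.1 y x := by simp [nonleast]

theorem Congruences.le_of_notMem_nonleast {x y : L} (h : θ.1 x y) (hx : x ∉ nonleast θ) :
    x ≤ y := by
  by_contra hxy
  refine hx (mem_nonleast.2 ⟨y ⊓ x, inf_lt_right.2 hxy, ?_⟩)
  have := Congruences.inf_right θ (θ.1.symm h) x
  rwa [inf_idem] at this

variable (θ)

/-- Every class of a finite lattice congruence has exactly one least element, so the elements
outside `nonleast θ` represent the classes. -/
theorem card_sub_card_quotient_eq_card_nonleast :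
    Fintype.card L - Nat.card (Quotient θ.1) = (nonleast θ).card := by
  have hbij : Function.Bijective
      (fun x : {x : L // x ∉ nonleast θ} => Quotient.mk θ.1 x.1) := by
    constructor
    · intro x y h
      have h' : θ.1 x.1 y.1 := Quotient.exact h
      exact Subtype.ext ((Congruences.le_of_notMem_nonleast h' x.2).antisymm
        (Congruences.le_of_notMem_nonleast (θ.1.symm h') y.2))
    · intro q
      induction q using Quotient.inductionOn with
      | _ a =>
      obtain ⟨b, hb⟩ := exists_minimal (s := univ.filter fun b => θ.1 b a) ⟨a, by simp⟩
      have hba : θ.1 b a := by simpa using hb.1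
      refine ⟨⟨b, fun hbn => ?_⟩, Quotient.sound hba⟩
      obtain ⟨c, hcb, hc⟩ := mem_nonleast.1 hbn
      exact hcb.not_ge (hb.2 (by simpa using θ.1.trans hc hba) hcb.le)
  have h1 := Nat.card_congr (Equiv.ofBijective _ hbij)
  rw [Nat.card_eq_fintype_card, Fintype.card_subtype_compl, Fintype.card_coe] at h1
  have := card_le_univ (nonleast θ)
  omega

/-- The sup-irreducible elements collapsed by a congruence. -/
noncomputable def collapsed : Finset L := (nonleast θ).filter SupIrred

variable {θ}

theorem mem_collapsed {x : L} : x ∈ collapsed θ ↔ x ∈ nonleast θ ∧ SupIrred x := by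
  simp [collapsed]

variable (θ)

theorem collapsed_subset : collapsed θ ⊆ supIrreds L :=
  fun _ hx => mem_supIrreds.2 (mem_collapsed.1 hx).2

variable {θ}

/-- Well-founded induction shows `y` related to `z ⊔ y` for all `z ≤ x`: a collapsed irreducible is
related to a smaller element, an uncollapsed one lies below `y`, and a reducible element splits into
two smaller ones. -/
theorem Congruences.rel_sup_of_forall {x y : L}
    (h : ∀ j, SupIrred j → j ∉ nonleast θ → j ≤ x → j ≤ y) : θ.1 y (x ⊔ y) := by
  suffices H : ∀ z, z ≤ x → θ.1 y (z ⊔ y) from H x le_rfl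
  intro z
  induction z using (wellFounded_lt (α := L)).induction with
  | _ z ih =>
  intro hzx
  by_cases hz : SupIrred z
  · by_cases hzn : z ∈ nonleast θ
    · obtain ⟨w, hwz, hw⟩ := mem_nonleast.1 hzn
      exact θ.1.trans (ih w hwz (hwz.le.trans hzx)) (Congruences.sup_right θ hw y)
    · rw [sup_eq_right.2 (h z hz hzn hzx)]
  · rcases not_supIrred.1 hz with hmin | ⟨b, c, rfl, hb, hc⟩
    · have : z ≤ y := (hmin inf_le_left).trans inf_le_right
      rw [sup_eq_right.2 this]
    · have := Congruences.sup_sup θ (ih b hb (hb.le.trans hzx)) (ih c hc (hc.le.trans hzx))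
      rwa [sup_idem, ← sup_sup_distrib_right] at this

/-- This recovers `θ` from the irreducibles it does not collapse, whence `collapsed_injective`. -/
theorem Congruences.rel_iff_forall {x y : L} :
    θ.1 x y ↔ ∀ j, SupIrred j → j ∉ nonleast θ → (j ≤ x ↔ j ≤ y) := by
  constructor
  · intro h j _ hjn
    suffices H : ∀ x y, θ.1 x y → j ≤ x → j ≤ y from ⟨H x y h, H y x (θ.1.symm h)⟩
    intro x y h hjx
    have h1 := Congruences.inf_right θ h j
    rw [inf_eq_right.2 hjx] at h1
    exact (le_of_notMem_nonleast h1 hjn).trans inf_le_left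
  · intro h
    have h1 : θ.1 y (x ⊔ y) := rel_sup_of_forall fun j h1 h2 => (h j h1 h2).1
    have h2 : θ.1 x (y ⊔ x) := rel_sup_of_forall fun j h1 h2 => (h j h1 h2).2
    rw [sup_comm] at h2
    exact θ.1.trans h2 (θ.1.symm h1)

theorem collapsed_injective :
    Function.Injective (fun θ : Congruences latticeLanguage L => collapsed θ) := by
  intro θ ψ h
  have h' : ∀ j, SupIrred j → (j ∉ nonleast θ ↔ j ∉ nonleast ψ) := by
    intro j hj
    have := congrArg (j ∈ ·) h
    simpa [mem_collapsed, hj, not_iff_not] using this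
  refine Subtype.ext (Setoid.ext fun x y => ?_)
  rw [Congruences.rel_iff_forall, Congruences.rel_iff_forall]
  exact forall_congr' fun j => forall_congr' fun hj => by rw [h' j hj]

end

section
variable (L : Type*) [Lattice L] [Fintype L]

/-- The elements that are joins of two strictly smaller elements. -/
noncomputable def supReds : Finset L := univ.filter fun x => ¬ SupIrred x ∧ ¬ IsMin x

variable {L}

theorem mem_supReds {x : L} : x ∈ supReds L ↔ ∃ b c, ¬ b ≤ c ∧ ¬ c ≤ b ∧ b ⊔ c = x := by
  simp only [supReds, mem_filter, mem_univ, true_and, not_supIrred]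
  constructor
  · rintro ⟨h | ⟨b, c, rfl, hb, hc⟩, hn⟩
    · exact absurd h hn
    · exact ⟨b, c, fun h => hc.ne (sup_eq_right.2 h).symm, fun h => hb.ne (sup_eq_left.2 h).symm,
        rfl⟩
  · rintro ⟨b, c, hbc, hcb, rfl⟩
    have h1 : b < b ⊔ c := left_lt_sup.2 hcb
    have h2 : c < b ⊔ c := right_lt_sup.2 hbc
    exact ⟨Or.inr ⟨b, c, rfl, h1, h2⟩, fun h => h.not_lt h1⟩

theorem mem_supReds_of_incomp {a b : L} (h1 : ¬ a ≤ b) (h2 : ¬ b ≤ a) : a ⊔ b ∈ supReds L :=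
  mem_supReds.2 ⟨a, b, h1, h2, rfl⟩

theorem supIrred_or_mem_supReds {x : L} (h : ¬ IsMin x) : SupIrred x ∨ x ∈ supReds L := by
  by_cases hx : SupIrred x
  · exact Or.inl hx
  · exact Or.inr (mem_filter.2 ⟨mem_univ _, hx, h⟩)

theorem nonleast_subset (θ : Congruences latticeLanguage L) :
    nonleast θ ⊆ collapsed θ ∪ supReds L := by
  intro x hx
  obtain ⟨y, hy, -⟩ := mem_nonleast.1 hx
  rw [mem_union, mem_collapsed]
  exact (supIrred_or_mem_supReds fun h => h.not_lt hy).imp (fun h => ⟨hx, h⟩) id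

/-- The final 1 counts the bottom element, which is neither irreducible nor a join of smaller
elements. -/
theorem card_supIrreds_add_card_supReds [Nonempty L] :
    Fintype.card L = (supIrreds L).card + (supReds L).card + 1 := by
  let _ := Fintype.toOrderBot L
  have h1 := card_filter_add_card_filter_not (s := (univ : Finset L)) SupIrred
  have h2 := card_filter_add_card_filter_not (s := (univ : Finset L).filter fun x => ¬ SupIrred x)
    IsMin
  rw [filter_filter, filter_filter] at h2
  have h3 : (univ : Finset L).filter (fun x => ¬ SupIrred x ∧ IsMin x) = {⊥} := by
    ext x
    simp only [mem_filter, mem_univ, true_and, mem_singleton, isMin_iff_eq_bot]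
    exact ⟨fun h => h.2, fun h => ⟨h ▸ not_supIrred_bot, h⟩⟩
  rw [h3, card_singleton] at h2
  rw [card_univ] at h1
  simp only [supIrreds, supReds]
  omega

theorem latticeCE_eq [Fintype (Congruences latticeLanguage L)] : latticeCE L = ((2 * ∑ θ : Congruences latticeLanguage L,
    (nonleast θ).card : ℕ) : ℝ) := by
  rw [latticeCE, congruenceEnergy_eq]
  simp only [card_sub_card_quotient_eq_card_nonleast]

theorem isChainLattice_iff : IsChainLattice L ↔ (supReds L).card = 0 := by
  rw [card_eq_zero, eq_empty_iff_forall_notMem]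
  constructor
  · intro h x hx
    obtain ⟨b, c, h1, h2, -⟩ := mem_supReds.1 hx
    exact (h b c).elim h1 h2
  · intro h x y
    by_contra! hxy
    exact h _ (mem_supReds_of_incomp hxy.1 hxy.2)

theorem card_nonleast_le (θ : Congruences latticeLanguage L) :
    (nonleast θ).card ≤ (collapsed θ).card + (supReds L).card :=
  (card_le_card (nonleast_subset θ)).trans (card_union_le _ _)

/-- The congruence that relates two elements lying above the same members of `M`. The hypothesis on
`M`, a weakening of all members being join-prime, makes this relation compatible with joins. -/
def congruenceOfFiltering (M : Finset L)
    (hM : ∀ x y, ∀ p ∈ M, p ≤ x ⊔ y → p ≤ x ∨ p ≤ y ∨ ∃ q ∈ M, ∃ r ∈ M,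
      p ≤ q ⊔ r ∧ q ≤ x ∧ r ≤ y) : Congruences latticeLanguage L :=
  ⟨⟨fun x y => ∀ p ∈ M, p ≤ x ↔ p ≤ y, fun _ _ _ => Iff.rfl, fun h p hp => (h p hp).symm,
    fun h h' p hp => (h p hp).trans (h' p hp)⟩, isCongruence_latticeLanguage_iff.2 (by
    constructor
    · intro a b c d hab hcd p hp
      rw [le_inf_iff, le_inf_iff, hab p hp, hcd p hp]
    · suffices H : ∀ a b c d : L, (∀ p ∈ M, p ≤ a ↔ p ≤ b) → (∀ p ∈ M, p ≤ c ↔ p ≤ d) →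
          ∀ p ∈ M, p ≤ a ⊔ c → p ≤ b ⊔ d from
        fun a b c d hab hcd p hp => ⟨H a b c d hab hcd p hp,
          H b a d c (fun p hp => (hab p hp).symm) (fun p hp => (hcd p hp).symm) p hp⟩
      intro a b c d hab hcd p hp h
      rcases hM a c p hp h with h | h | ⟨q, hq, r, hr, h, hqa, hrc⟩
      · exact ((hab p hp).1 h).trans le_sup_left
      · exact ((hcd p hp).1 h).trans le_sup_right
      · exact h.trans (sup_le_sup ((hab q hq).1 hqa) ((hcd r hr).1 hrc)))⟩

theorem SupIrred.exists_lt_forall_lt_le {x : L} (hx : SupIrred x) : ∃ y < x, ∀ z < x, z ≤ y := by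
  have hne : Nonempty L := ⟨x⟩
  obtain ⟨b, hbx⟩ := not_isMin_iff.1 hx.not_isMin
  obtain ⟨y, hy⟩ := exists_maximal (s := univ.filter (· < x)) ⟨b, by simpa using hbx⟩
  have hyx : y < x := by simpa using hy.1
  refine ⟨y, hyx, fun z hz => ?_⟩
  have hlt : z ⊔ y < x := lt_of_le_of_ne (sup_le hz.le hyx.le) fun h =>
    (hx.2 h).elim hz.ne hyx.ne
  exact le_sup_left.trans (hy.2 (by simpa using hlt) le_sup_right)

/-- An irreducible `x` has a greatest element `y` strictly below it, and only `x` itself, as a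
member of `M`, can separate `y` from `x`. -/
theorem mem_nonleast_congruenceOfFiltering {M : Finset L} (hM) {x : L} (hx : SupIrred x) :
    x ∈ nonleast (congruenceOfFiltering M hM) ↔ x ∉ M := by
  rw [mem_nonleast]
  constructor
  · rintro ⟨y, hy, h⟩ hxM
    exact hy.not_ge ((h x hxM).2 le_rfl)
  · intro hxM
    obtain ⟨y, hyx, hy⟩ := hx.exists_lt_forall_lt_le
    exact ⟨y, hyx, fun p hp => ⟨fun h => h.trans hyx.le, fun h =>
      hy p (lt_of_le_of_ne h fun h' => hxM (h' ▸ hp))⟩⟩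

theorem collapsed_congruenceOfFiltering {M X : Finset L} (hM) (hX : X ⊆ supIrreds L)
    (h : ∀ x, SupIrred x → (x ∈ M ↔ x ∉ X)) :
    collapsed (congruenceOfFiltering M hM) = X := by
  ext x
  rw [mem_collapsed]
  by_cases hx : SupIrred x
  · rw [mem_nonleast_congruenceOfFiltering hM hx, h x hx, not_not]
    simp [hx]
  · simp only [hx, and_false, false_iff]
    exact fun h' => hx (mem_supIrreds.1 (hX h'))

end

end LatticeCongruences

/-! ### Incomparable pairs and the second largest value -/

section Incomparable
open Finset Classical

/-- `a` and `b` are incomparable, and there is no other pair of incomparable elements. -/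
def IsUniqueIncompPair {L : Type*} [LE L] (a b : L) : Prop :=
  ¬ a ≤ b ∧ ¬ b ≤ a ∧ ∀ x y : L, ¬ x ≤ y → ¬ y ≤ x → x = a ∨ x = b

variable {L : Type*} [Lattice L]

theorem IsUniqueIncompPair.symm {a b : L} (h : IsUniqueIncompPair a b) :
    IsUniqueIncompPair b a :=
  ⟨h.2.1, h.1, fun x y h1 h2 => (h.2.2 x y h1 h2).symm⟩

theorem IsUniqueIncompPair.le_or_le {a b x y : L} (h : IsUniqueIncompPair a b) (ha : x ≠ a)
    (hb : x ≠ b) : x ≤ y ∨ y ≤ x := by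
  by_contra! hxy
  exact (h.2.2 x y hxy.1 hxy.2).elim ha hb

theorem IsUniqueIncompPair.le_or_le_or_sup_le {a b : L} (h : IsUniqueIncompPair a b) (x : L) :
    x ≤ a ∨ x ≤ b ∨ a ⊔ b ≤ x := by
  by_cases ha : x = a
  · exact Or.inl ha.le
  by_cases hb : x = b
  · exact Or.inr (Or.inl hb.le)
  rcases h.le_or_le (y := a) ha hb with h1 | h1
  · exact Or.inl h1
  rcases h.le_or_le (y := b) ha hb with h2 | h2
  · exact Or.inr (Or.inl h2)
  exact Or.inr (Or.inr (sup_le h1 h2))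

theorem IsUniqueIncompPair.le_of_lt {a b x : L} (h : IsUniqueIncompPair a b) (hx : x < a) :
    x ≤ b := by
  by_cases hb : x = b
  · exact hb.le
  · exact (h.le_or_le (y := b) hx.ne hb).resolve_right fun h' => h.2.1 (h'.trans hx.le)

theorem IsUniqueIncompPair.sup_eq {a b x y : L} (h : IsUniqueIncompPair a b) (h1 : ¬ x ≤ y)
    (h2 : ¬ y ≤ x) : x ⊔ y = a ⊔ b := by
  rcases h.2.2 x y h1 h2 with rfl | rfl <;> rcases h.2.2 y x h2 h1 with rfl | rfl
  · exact absurd le_rfl h1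
  · rfl
  · exact sup_comm _ _
  · exact absurd le_rfl h1

theorem IsUniqueIncompPair.le_or_le_of_le_sup {a b p x y : L} (h : IsUniqueIncompPair a b)
    (hp : p ≠ a ⊔ b) (hxy : p ≤ x ⊔ y) : p ≤ x ∨ p ≤ y := by
  by_cases h1 : x ≤ y
  · exact Or.inr (by rwa [sup_eq_right.2 h1] at hxy)
  by_cases h2 : y ≤ x
  · exact Or.inl (by rwa [sup_eq_left.2 h2] at hxy)
  have hlt : p < a ⊔ b := lt_of_le_of_ne (h.sup_eq h1 h2 ▸ hxy) hp
  rcases h.2.2 x y h1 h2 with rfl | rfl <;> rcases h.2.2 y x h2 h1 with rfl | rfl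
  · exact absurd le_rfl h1
  · rcases h.le_or_le_or_sup_le p with h3 | h3 | h3
    exacts [Or.inl h3, Or.inr h3, absurd h3 hlt.not_ge]
  · rcases h.le_or_le_or_sup_le p with h3 | h3 | h3
    exacts [Or.inr h3, Or.inl h3, absurd h3 hlt.not_ge]
  · exact absurd le_rfl h1

variable [Fintype L]

/-- Take `w < z` related to `z`. Joining with `b` relates `b` to `z ⊔ b`, and meeting with `a` then
relates `b ⊓ a < a` to `a`. -/
theorem mem_nonleast_of_sup {θ : Congruences latticeLanguage L} {z a b : L} (hz : z ∈ nonleast θ)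
    (hzb : ∀ w < z, w ≤ b) (hab : ¬ a ≤ b) (ha : a ≤ z ⊔ b) : a ∈ nonleast θ := by
  obtain ⟨w, hwz, hw⟩ := mem_nonleast.1 hz
  have h1 := Congruences.inf_right θ (Congruences.sup_right θ hw b) a
  rw [sup_eq_right.2 (hzb w hwz), inf_eq_right.2 ha] at h1
  exact mem_nonleast.2 ⟨_, inf_lt_right.2 hab, h1⟩

section OneSupRed
variable {v : L} (hv : supReds L = {v})
include hv

theorem sup_eq_of_supReds_eq_singleton {x y : L} (h1 : ¬ x ≤ y) (h2 : ¬ y ≤ x) : x ⊔ y = v := by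
  have := mem_supReds_of_incomp h1 h2
  rwa [hv, mem_singleton] at this

theorem lt_of_supReds_eq_singleton {x y : L} (h1 : ¬ x ≤ y) (h2 : ¬ y ≤ x) : x < v := by
  rw [← sup_eq_of_supReds_eq_singleton hv h1 h2]
  exact left_lt_sup.2 h2

theorem supIrred_of_supReds_eq_singleton {x y : L} (h1 : ¬ x ≤ y) (h2 : ¬ y ≤ x) :
    SupIrred x := by
  refine (supIrred_or_mem_supReds fun h => h1 ((h inf_le_left).trans inf_le_right)).resolve_right ?_
  rw [hv, mem_singleton]
  exact (lt_of_supReds_eq_singleton hv h1 h2).ne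

theorem exists_collapsed_implication {a b : L} (hab : ¬ a ≤ b) (hba : ¬ b ≤ a)
    (hu : ∀ a b : L, ¬ IsUniqueIncompPair a b) :
    ∃ p ∈ supIrreds L, ∃ q ∈ supIrreds L, p ≠ q ∧
      ∀ θ : Congruences latticeLanguage L, p ∈ collapsed θ → q ∈ collapsed θ := by
  simp only [mem_supIrreds, mem_collapsed]
  by_cases hC : ∃ x y z : L, ¬ x ≤ y ∧ ¬ y ≤ x ∧ z < x ∧ ¬ z ≤ y
  · obtain ⟨x, y, t, hxy, hyx, htx, hty⟩ := hC
    -- Minimality puts everything strictly below `z` under `y`. Since `z ⊔ y = v ≥ x`, collapsing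
    -- `z` collapses `x`.
    obtain ⟨z, hz⟩ := exists_minimal (s := univ.filter fun z => z < x ∧ ¬ z ≤ y)
      ⟨t, by simp [htx, hty]⟩
    obtain ⟨hzx, hzy⟩ : z < x ∧ ¬ z ≤ y := by simpa using hz.1
    have hyz : ¬ y ≤ z := fun h => hyx (h.trans hzx.le)
    have hx := supIrred_of_supReds_eq_singleton hv hxy hyx
    refine ⟨z, supIrred_of_supReds_eq_singleton hv hzy hyz, x, hx, hzx.ne, fun θ h => ⟨?_, hx⟩⟩
    refine mem_nonleast_of_sup h.1 (fun w hw => ?_) hxy ?_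
    · by_contra hwy
      exact hw.not_ge (hz.2 (by simp [hw.trans hzx, hwy]) hw.le)
    · rw [sup_eq_of_supReds_eq_singleton hv hzy hyz]
      exact (lt_of_supReds_eq_singleton hv hxy hyx).le
  · push Not at hC
    -- In the remaining case the elements that belong to incomparable pairs form an antichain. A
    -- third such element `c` yields `a ⊔ c = v ≥ b`, so collapsing `a` collapses `b`.
    have key : ∀ x y x' y' : L, ¬ x ≤ y → ¬ y ≤ x → ¬ x' ≤ y' → ¬ y' ≤ x' → ¬ x < x' := by
      intro x y x' y' h1 h2 h3 h4 hlt
      by_cases h5 : x' ≤ y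
      · exact h1 (hlt.le.trans h5)
      by_cases h6 : y ≤ x'
      · have h7 := lt_of_supReds_eq_singleton hv h3 h4
        rw [← sup_eq_of_supReds_eq_singleton hv h1 h2] at h7
        exact h7.not_ge (sup_le hlt.le h6)
      · exact h1 (hC x' y x h5 h6 hlt)
    obtain ⟨c, d, hcd, hdc, hca, hcb⟩ : ∃ c d : L, ¬ c ≤ d ∧ ¬ d ≤ c ∧ c ≠ a ∧ c ≠ b := by
      by_contra! h
      exact hu a b ⟨hab, hba, fun x y h1 h2 => or_iff_not_imp_left.2 (h x y h1 h2)⟩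
    have hac : ¬ a ≤ c := fun h => key a b c d hab hba hcd hdc (lt_of_le_of_ne h hca.symm)
    have hca' : ¬ c ≤ a := fun h => key c d a b hcd hdc hab hba (lt_of_le_of_ne h hca)
    have hbc : ¬ b ≤ c := fun h => key b a c d hba hab hcd hdc (lt_of_le_of_ne h hcb.symm)
    have hb := supIrred_of_supReds_eq_singleton hv hba hab
    refine ⟨a, supIrred_of_supReds_eq_singleton hv hab hba, b, hb, fun h => hab h.le,
      fun θ h => ⟨?_, hb⟩⟩
    refine mem_nonleast_of_sup h.1 (fun w hw => hC a c w hac hca' hw) hbc ?_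
    rw [sup_eq_of_supReds_eq_singleton hv hac hca']
    exact (lt_of_supReds_eq_singleton hv hba hab).le

end OneSupRed

theorem IsUniqueIncompPair.supReds_eq {a b : L} (h : IsUniqueIncompPair a b) :
    supReds L = {a ⊔ b} := by
  ext x
  rw [mem_supReds, mem_singleton]
  constructor
  · rintro ⟨c, d, h1, h2, rfl⟩
    exact h.sup_eq h1 h2
  · rintro rfl
    exact ⟨a, b, h.1, h.2.1, rfl⟩

theorem IsUniqueIncompPair.sup_mem_nonleast {a b : L} (h : IsUniqueIncompPair a b)
    {θ : Congruences latticeLanguage L} (ha : a ∈ nonleast θ) : a ⊔ b ∈ nonleast θ :=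
  mem_nonleast_of_sup ha (fun _ hw => h.le_of_lt hw) (fun h' => h.1 (le_sup_left.trans h')) le_rfl

/-- An element strictly below `a ⊔ b` lies below `a` or below `b`. If it is related to `a ⊔ b`,
meeting with the other of the two collapses that one. -/
theorem IsUniqueIncompPair.sup_mem_nonleast_iff {a b : L} (h : IsUniqueIncompPair a b)
    (θ : Congruences latticeLanguage L) :
    a ⊔ b ∈ nonleast θ ↔ a ∈ nonleast θ ∨ b ∈ nonleast θ := by
  constructor
  · intro hv
    have key : ∀ c d : L, ¬ c ≤ d → c ≤ a ⊔ b → ∀ w ≤ d, θ.1 w (a ⊔ b) → c ∈ nonleast θ := by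
      intro c d hcd hc w hw hθ
      have h1 := Congruences.inf_right θ hθ c
      rw [inf_eq_right.2 hc] at h1
      exact mem_nonleast.2 ⟨_, inf_lt_right.2 fun h' => hcd (h'.trans hw), h1⟩
    obtain ⟨w, hw, hθ⟩ := mem_nonleast.1 hv
    rcases h.le_or_le_or_sup_le w with h1 | h1 | h1
    · exact Or.inr (key b a h.2.1 le_sup_right w h1 hθ)
    · exact Or.inl (key a b h.1 le_sup_left w h1 hθ)
    · exact absurd h1 hw.not_ge
  · rintro (h' | h')
    · exact h.sup_mem_nonleast h'
    · rw [sup_comm]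
      exact h.symm.sup_mem_nonleast h'

theorem IsUniqueIncompPair.supIrred {a b : L} (h : IsUniqueIncompPair a b) : SupIrred a :=
  supIrred_of_supReds_eq_singleton h.supReds_eq h.1 h.2.1

theorem IsUniqueIncompPair.card_nonleast {a b : L} (h : IsUniqueIncompPair a b)
    (θ : Congruences latticeLanguage L) : (nonleast θ).card =
      (collapsed θ).card + if a ∈ collapsed θ ∨ b ∈ collapsed θ then 1 else 0 := by
  have hiff : (a ∈ collapsed θ ∨ b ∈ collapsed θ) ↔ a ⊔ b ∈ nonleast θ := by
    rw [h.sup_mem_nonleast_iff, mem_collapsed, mem_collapsed]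
    simp [h.supIrred, h.symm.supIrred]
  have hsub := nonleast_subset θ
  rw [h.supReds_eq, union_comm, ← insert_eq] at hsub
  have hv : a ⊔ b ∉ collapsed θ := fun hmem => by
    rcases (mem_collapsed.1 hmem).2.2 rfl with h' | h'
    · exact h.2.1 (sup_eq_left.1 h'.symm)
    · exact h.1 (sup_eq_right.1 h'.symm)
  rw [if_congr hiff rfl rfl]
  split_ifs with hmem
  · rw [← card_insert_of_notMem hv]
    congr 1
    exact hsub.antisymm (insert_subset hmem (filter_subset _ _))
  · rw [add_zero]
    congr 1
    exact ((subset_insert_iff_of_notMem hmem).1 hsub).antisymm (filter_subset _ _)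

/-- All elements but `a ⊔ b` satisfy the join-prime condition, so the irreducibles outside `X` may
serve as a filtering set. The element `a ⊔ b` is added only when `a` and `b` are both in that set,
and they are then the witnesses for the third alternative. -/
theorem IsUniqueIncompPair.exists_collapsed_eq {a b : L} (h : IsUniqueIncompPair a b)
    {X : Finset L} (hX : X ⊆ supIrreds L) :
    ∃ θ : Congruences latticeLanguage L, collapsed θ = X := by
  have ha := mem_supIrreds.2 h.supIrred
  have hb := mem_supIrreds.2 h.symm.supIrred
  have hv : ¬ SupIrred (a ⊔ b) := fun hv => by
    rcases hv.2 rfl with h' | h'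
    · exact h.2.1 (sup_eq_left.1 h'.symm)
    · exact h.1 (sup_eq_right.1 h'.symm)
  refine ⟨congruenceOfFiltering ((supIrreds L \ X) ∪ if a ∈ X ∨ b ∈ X then ∅ else {a ⊔ b}) ?_,
    collapsed_congruenceOfFiltering _ hX ?_⟩
  · intro x y p hp hpxy
    by_cases hpv : p = a ⊔ b
    · subst hpv
      have hmem : a ∉ X ∧ b ∉ X := by
        rw [mem_union] at hp
        rcases hp with hp | hp
        · exact absurd (mem_supIrreds.1 (mem_sdiff.1 hp).1) hv
        · split_ifs at hp with h'
          · simp at hp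
          · simpa using h'
      have haM := mem_union_left (if a ∈ X ∨ b ∈ X then ∅ else {a ⊔ b})
        (mem_sdiff.2 ⟨ha, hmem.1⟩)
      have hbM := mem_union_left (if a ∈ X ∨ b ∈ X then ∅ else {a ⊔ b})
        (mem_sdiff.2 ⟨hb, hmem.2⟩)
      by_cases h1 : x ≤ y
      · exact Or.inr (Or.inl (by rwa [sup_eq_right.2 h1] at hpxy))
      by_cases h2 : y ≤ x
      · exact Or.inl (by rwa [sup_eq_left.2 h2] at hpxy)
      right; right
      rcases h.2.2 x y h1 h2 with rfl | rfl <;> rcases h.2.2 y x h2 h1 with rfl | rfl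
      · exact absurd le_rfl h1
      · exact ⟨_, haM, _, hbM, le_rfl, le_rfl, le_rfl⟩
      · exact ⟨_, hbM, _, haM, sup_comm _ _ |>.le, le_rfl, le_rfl⟩
      · exact absurd le_rfl h1
    · exact (h.le_or_le_of_le_sup hpv hpxy).imp_right Or.inl
  · intro x hx
    have hxv : x ≠ a ⊔ b := fun h' => hv (h' ▸ hx)
    rw [mem_union, mem_sdiff, mem_supIrreds]
    split_ifs <;> simp [hx, hxv]

section Energy
variable [Fintype (Congruences latticeLanguage L)]

theorem two_mul_sum_card_nonleast_le :
    2 * ∑ θ : Congruences latticeLanguage L, (nonleast θ).card ≤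
      2 ^ (supIrreds L).card * ((supIrreds L).card + 2 * (supReds L).card) :=
  two_mul_sum_le_of_injective_powerset collapsed_injective (fun θ => collapsed_subset θ) card_nonleast_le

theorem two_mul_sum_card_nonleast_of_isChainLattice (h : IsChainLattice L) :
    2 * ∑ θ : Congruences latticeLanguage L, (nonleast θ).card =
      2 ^ (supIrreds L).card * (supIrreds L).card := by
  have h0 := isChainLattice_iff.1 h
  have heq : ∀ θ : Congruences latticeLanguage L, nonleast θ = collapsed θ := fun θ =>
    (by simpa [card_eq_zero.1 h0] using nonleast_subset θ : nonleast θ ⊆ collapsed θ).antisymm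
      (filter_subset _ _)
  simp only [heq]
  rw [sum_eq_sum_powerset collapsed_injective (fun θ => collapsed_subset θ) ?_ card,
    two_mul_sum_powerset_card]
  intro X hX
  refine ⟨congruenceOfFiltering (supIrreds L \ X) ?_, collapsed_congruenceOfFiltering _ hX ?_⟩
  · intro x y p _ hp
    rcases h x y with hxy | hxy
    · exact Or.inr (Or.inl (by rwa [sup_eq_right.2 hxy] at hp))
    · exact Or.inl (by rwa [sup_eq_left.2 hxy] at hp)
  · intro x hx
    simp [mem_supIrreds, hx]

theorem IsUniqueIncompPair.four_mul_sum_card_nonleast {a b : L} (h : IsUniqueIncompPair a b) :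
    4 * ∑ θ : Congruences latticeLanguage L, (nonleast θ).card =
      2 ^ (supIrreds L).card * (2 * (supIrreds L).card + 3) := by
  simp only [h.card_nonleast]
  rw [sum_eq_sum_powerset collapsed_injective (fun θ => collapsed_subset θ)
    (fun X hX => h.exists_collapsed_eq hX) fun X => X.card + if a ∈ X ∨ b ∈ X then 1 else 0]
  exact two_mul_sum_powerset_card_add_ite (mem_supIrreds.2 h.supIrred)
    (mem_supIrreds.2 h.symm.supIrred) fun hab => h.1 hab.le

theorem four_mul_sum_card_nonleast_lt {a b : L} (hab : ¬ a ≤ b) (hba : ¬ b ≤ a)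
    (hu : ∀ a b : L, ¬ IsUniqueIncompPair a b) :
    8 * ∑ θ : Congruences latticeLanguage L, (nonleast θ).card <
      2 ^ ((supIrreds L).card + (supReds L).card) *
        (2 * ((supIrreds L).card + (supReds L).card) + 1) := by
  have hpos : 0 < (supReds L).card := card_pos.2 ⟨_, mem_supReds_of_incomp hab hba⟩
  rcases Nat.lt_or_ge 1 (supReds L).card with h | h
  · have h1 := two_mul_sum_card_nonleast_le (L := L)
    have h2 := four_mul_two_pow_mul_lt (r := (supIrreds L).card) h
    omega
  · have h1 : (supReds L).card = 1 := by omega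
    obtain ⟨v, hv⟩ := card_eq_one.1 h1
    obtain ⟨p, hp, q, hq, hpq, himp⟩ := exists_collapsed_implication hv hab hba hu
    have h2 := two_mul_sum_lt_of_implication collapsed_injective (fun θ => collapsed_subset θ)
      (f := fun θ : Congruences latticeLanguage L => (nonleast θ).card)
      (fun θ => h1 ▸ card_nonleast_le θ) hp hq hpq himp
    have h3 : 0 < 2 ^ (supIrreds L).card := by positivity
    -- For a single reducible element the implication bound reads `8 * Σ ≤ 2 ^ r * (4 * r + 4)`,
    -- against the target `2 ^ r * (4 * r + 6)`.
    rw [h1, pow_succ]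
    nlinarith

theorem two_mul_sum_card_nonleast_lt {a b : L} (hab : ¬ a ≤ b) (hba : ¬ b ≤ a)
    (hcard : 2 ≤ (supIrreds L).card + (supReds L).card) :
    2 * ∑ θ : Congruences latticeLanguage L, (nonleast θ).card <
      ((supIrreds L).card + (supReds L).card) * 2 ^ ((supIrreds L).card + (supReds L).card) :=
  two_mul_sum_card_nonleast_le.trans_lt
    (two_pow_mul_lt (card_pos.2 ⟨_, mem_supReds_of_incomp hab hba⟩) hcard)

end Energy

theorem four_le_card_of_incomp {a b : L} (hab : ¬ a ≤ b) (hba : ¬ b ≤ a) : 4 ≤ Fintype.card L := by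
  have h1 : a ⊓ b < a := inf_lt_left.2 hab
  have h2 : a ⊓ b < b := inf_lt_right.2 hba
  have h3 : a < a ⊔ b := left_lt_sup.2 hba
  have h4 : b < a ⊔ b := right_lt_sup.2 hab
  have h5 : a ≠ b := fun h => hab h.le
  have : ({a ⊓ b, a, b, a ⊔ b} : Finset L).card = 4 := by
    rw [card_insert_of_notMem, card_insert_of_notMem, card_insert_of_notMem, card_singleton]
    · simp [h4.ne]
    · simp [h5, h3.ne]
    · simp only [mem_insert, mem_singleton, not_or]
      exact ⟨h1.ne, h2.ne, (h1.trans h3).ne⟩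
  rw [← this]
  exact card_le_univ _

end Incomparable

/-! ### Unique incomparable pairs and glued sums -/

section GluedSums

theorem existsUnique_antichain_iff {L : Type*} [PartialOrder L] :
    (∃! S : Set L, S.ncard = 2 ∧ IsAntichain (· ≤ ·) S) ↔ ∃ a b : L, IsUniqueIncompPair a b := by
  have hpair : ∀ x y : L, ¬ x ≤ y → ¬ y ≤ x →
      ({x, y} : Set L).ncard = 2 ∧ IsAntichain (· ≤ ·) ({x, y} : Set L) := by
    intro x y hxy hyx
    refine ⟨Set.ncard_pair fun h => hxy h.le, ?_⟩
    rintro p (rfl | rfl) q (rfl | rfl) hne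
    exacts [absurd rfl hne, hxy, hyx, absurd rfl hne]
  have hof : ∀ S : Set L, S.ncard = 2 → IsAntichain (· ≤ ·) S →
      ∃ x y, ¬ x ≤ y ∧ ¬ y ≤ x ∧ S = {x, y} := by
    intro S h2 hS
    obtain ⟨x, y, hne, rfl⟩ := Set.ncard_eq_two.1 h2
    exact ⟨x, y, hS (by simp) (by simp) hne, hS (by simp) (by simp) hne.symm, rfl⟩
  constructor
  · rintro ⟨S, ⟨h2, hS⟩, huniq⟩
    obtain ⟨a, b, hab, hba, rfl⟩ := hof S h2 hS
    refine ⟨a, b, hab, hba, fun x y hxy hyx => ?_⟩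
    have hx : x ∈ ({x, y} : Set L) := by simp
    rw [huniq _ (hpair x y hxy hyx)] at hx
    exact hx
  · rintro ⟨a, b, hab, hba, h⟩
    refine ⟨{a, b}, hpair a b hab hba, ?_⟩
    rintro T ⟨h2, hT⟩
    obtain ⟨x, y, hxy, hyx, rfl⟩ := hof T h2 hT
    rcases h x y hxy hyx with rfl | rfl <;> rcases h y x hyx hxy with rfl | rfl
    · exact absurd le_rfl hxy
    · rfl
    · exact Set.pair_comm _ _
    · exact absurd le_rfl hxy

theorem IsUniqueIncompPair.map {P Q : Type*} [LE P] [LE Q] (e : P ≃o Q) {a b : P}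
    (h : IsUniqueIncompPair a b) : IsUniqueIncompPair (e a) (e b) := by
  refine ⟨by simpa using h.1, by simpa using h.2.1, fun x y hxy hyx => ?_⟩
  have := h.2.2 (e.symm x) (e.symm y) (by simpa using hxy) (by simpa using hyx)
  simpa only [OrderIso.symm_apply_eq] using this

theorem IsUniqueIncompPair.lex_inl {U W : Type*} [LE U] [LE W]
    (hW : ∀ x y : W, x ≤ y ∨ y ≤ x) {a b : U} (h : IsUniqueIncompPair a b) :
    IsUniqueIncompPair (toLex (Sum.inl a : U ⊕ W)) (toLex (Sum.inl b : U ⊕ W)) := by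
  refine ⟨by simpa using h.1, by simpa using h.2.1, fun x y => ?_⟩
  induction x using Lex.rec with | _ x =>
  induction y using Lex.rec with | _ y =>
  rcases x with x | x <;> rcases y with y | y
  · simpa using h.2.2 x y
  · simp
  · simp
  · intro h1 h2
    simp only [Sum.Lex.inr_le_inr_iff] at h1 h2
    exact absurd (hW x y) (not_or.2 ⟨h1, h2⟩)

theorem IsUniqueIncompPair.lex_inr {U W : Type*} [LE U] [LE W]
    (hU : ∀ x y : U, x ≤ y ∨ y ≤ x) {a b : W} (h : IsUniqueIncompPair a b) :
    IsUniqueIncompPair (toLex (Sum.inr a : U ⊕ W)) (toLex (Sum.inr b : U ⊕ W)) := by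
  refine ⟨by simpa using h.1, by simpa using h.2.1, fun x y => ?_⟩
  induction x using Lex.rec with | _ x =>
  induction y using Lex.rec with | _ y =>
  rcases x with x | x <;> rcases y with y | y
  · intro h1 h2
    simp only [Sum.Lex.inl_le_inl_iff] at h1 h2
    exact absurd (hU x y) (not_or.2 ⟨h1, h2⟩)
  · simp
  · simp
  · simpa using h.2.2 x y

theorem isUniqueIncompPair_B4 : IsUniqueIncompPair (⟨(true, false), by decide⟩ : {x : B4 // x ≠ ⊥})
    ⟨(false, true), by decide⟩ := by
  unfold IsUniqueIncompPair
  decide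

theorem le_iff_le_of_lex {U W Q : Type*} [LE U] [LE W] [LE Q] {f : U → Q} {g : W → Q}
    (hf : ∀ x y, f x ≤ f y ↔ x ≤ y) (hg : ∀ x y, g x ≤ g y ↔ x ≤ y)
    (h1 : ∀ x y, f x ≤ g y) (h2 : ∀ x y, ¬ g y ≤ f x) (x y : U ⊕ₗ W) :
    Sum.elim f g (ofLex x) ≤ Sum.elim f g (ofLex y) ↔ x ≤ y := by
  induction x using Lex.rec with | _ x =>
  induction y using Lex.rec with | _ y =>
  rcases x with x | x <;> rcases y with y | y <;> simp [hf, hg, h1, h2]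

/-- A partial order in which any two elements are comparable, as a linear order. -/
noncomputable abbrev linearOrderOfTotal {P : Type*} [i : PartialOrder P]
    (h : ∀ x y : P, x ≤ y ∨ y ≤ x) : LinearOrder P :=
  { i with
    le_total := h
    toDecidableLE := Classical.decRel _ }

/-- Apart from `a` and `b`, every element lies below `a ⊓ b` or above `a ⊔ b`, and both of these
parts are chains. -/
theorem exists_isUniqueIncompPair_iff {L : Type w} [Lattice L] [Finite L] :
    (∃ a b : L, IsUniqueIncompPair a b) ↔ IsChainB4ChainSum L := by
  constructor
  · rintro ⟨a, b, h⟩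
    have total_below : ∀ x y : {x : L // x ≤ a ⊓ b}, x ≤ y ∨ y ≤ x := fun x y =>
      h.le_or_le (fun hx => h.1 (hx ▸ x.2.trans inf_le_right))
        fun hx => h.2.1 (hx ▸ x.2.trans inf_le_left)
    have total_above : ∀ x y : {x : L // a ⊔ b ≤ x}, x ≤ y ∨ y ≤ x := fun x y =>
      h.le_or_le (fun hx => h.2.1 (hx ▸ le_sup_right.trans x.2))
        fun hx => h.1 (hx ▸ le_sup_left.trans x.2)
    let _ : LinearOrder {x : L // x ≤ a ⊓ b} := linearOrderOfTotal total_below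
    let _ : LinearOrder {x : L // a ⊔ b ≤ x} := linearOrderOfTotal total_above
    let _ : OrderBot {x : L // a ⊔ b ≤ x} := { bot := ⟨a ⊔ b, le_rfl⟩, bot_le := fun x => x.2 }
    refine ⟨{x : L // x ≤ a ⊓ b}, {x : L // a ⊔ b ≤ x}, inferInstance, inferInstance,
      inferInstance, inferInstance, ⟨⟨a ⊓ b, le_rfl⟩⟩, inferInstance, ⟨OrderIso.symm ?_⟩⟩
    -- The bottom of `B4` is identified with `a ⊓ b`, the top of the lower chain; its top goes to `a
    -- ⊔ b`, which is therefore the element removed from the upper chain.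
    let g : {x : B4 // x ≠ ⊥} → L := fun p =>
      if p.1 = (true, false) then a else if p.1 = (false, true) then b else a ⊔ b
    have hg3 : ∀ p, g p = a ∨ g p = b ∨ g p = a ⊔ b := by
      intro p
      simp only [g]
      split_ifs <;> simp
    have hga : ∀ p, a ⊓ b ≤ g p ∧ g p ≤ a ⊔ b := by
      intro p
      rcases hg3 p with hp | hp | hp <;> rw [hp] <;>
        simp [inf_le_left.trans (le_sup_left : a ≤ a ⊔ b)]
    have hgn : ∀ p, ¬ g p ≤ a ⊓ b := by
      intro p hle
      rcases hg3 p with hp | hp | hp <;> rw [hp] at hle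
      · exact h.1 (hle.trans inf_le_right)
      · exact h.2.1 (hle.trans inf_le_left)
      · exact h.1 (le_sup_left.trans (hle.trans inf_le_right))
    have hg : ∀ p q, g p ≤ g q ↔ p ≤ q := by
      have h1 := h.1
      have h2 := h.2.1
      rintro ⟨⟨p1, p2⟩, hp⟩ ⟨⟨q1, q2⟩, hq⟩
      cases p1 <;> cases p2 <;> cases q1 <;> cases q2 <;>
        first
        | exact absurd rfl hp
        | exact absurd rfl hq
        | simp [g, h1, h2]
    have hf := le_iff_le_of_lex (f := fun x : {x : L // x ≤ a ⊓ b} => x.1) (g := g)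
      (fun _ _ => Iff.rfl) hg (fun x p => x.2.trans (hga p).1)
      (fun x p hle => hgn p (hle.trans x.2))
    have hk := le_iff_le_of_lex
      (g := fun z : {z : {x : L // a ⊔ b ≤ x} // z ≠ ⊥} => z.1.1) hf
      (fun _ _ => Iff.rfl) ?_ ?_
    · refine RelIso.ofSurjective (OrderEmbedding.ofMapLEIff _ hk) fun x => ?_
      have below : ∀ y, y ≤ a ⊓ b → ∃ t, Sum.elim (fun t => Sum.elim
          (fun x : {x : L // x ≤ a ⊓ b} => x.1) g (ofLex t))
          (fun z : {z : {x : L // a ⊔ b ≤ x} // z ≠ ⊥} => z.1.1) (ofLex t) = y := fun y hy =>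
        ⟨toLex (Sum.inl (toLex (Sum.inl ⟨y, hy⟩))), rfl⟩
      have mid : ∀ p, ∃ t, Sum.elim (fun t => Sum.elim
          (fun x : {x : L // x ≤ a ⊓ b} => x.1) g (ofLex t))
          (fun z : {z : {x : L // a ⊔ b ≤ x} // z ≠ ⊥} => z.1.1) (ofLex t) = g p := fun p =>
        ⟨toLex (Sum.inl (toLex (Sum.inr p))), rfl⟩
      rcases h.le_or_le_or_sup_le x with hx | hx | hx
      · rcases hx.eq_or_lt with rfl | hlt
        · exact mid ⟨(true, false), by decide⟩
        · exact below x (le_inf hx (h.le_of_lt hlt))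
      · rcases hx.eq_or_lt with rfl | hlt
        · exact mid ⟨(false, true), by decide⟩
        · exact below x (le_inf (h.symm.le_of_lt hlt) hx)
      · rcases hx.eq_or_lt with rfl | hlt
        · exact mid ⟨(true, true), by decide⟩
        · exact ⟨toLex (Sum.inr ⟨⟨x, hx⟩, fun h' => hlt.ne (congrArg Subtype.val h').symm⟩), rfl⟩
    · intro x z
      induction x using Lex.rec with | _ x =>
      rcases x with x | p
      · exact (x.2.trans (inf_le_left.trans le_sup_left)).trans z.1.2
      · exact (hga p).2.trans z.1.2
    · intro x z hle
      have hzv : ¬ z.1.1 ≤ a ⊔ b := fun h' => z.2 (Subtype.ext (h'.antisymm z.1.2))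
      induction x using Lex.rec with | _ x =>
      rcases x with x | p
      · exact hzv (hle.trans (x.2.trans (inf_le_left.trans le_sup_left)))
      · exact hzv (hle.trans (hga p).2)
  · rintro ⟨C', C'', _, _, _, -, -, -, ⟨e⟩⟩
    exact ⟨_, _, ((isUniqueIncompPair_B4.lex_inr le_total).lex_inl
      fun x y : {x : C'' // x ≠ ⊥} => le_total x.1 y.1).map e.symm⟩

end GluedSums

/-! ### The main theorem -/

theorem theorem1 (n : ℕ) (hn : 1 ≤ n) :
    -- (a) congruence distributive algebras of any type
    (∀ (𝓛 : FirstOrder.Language.{u, v}) [𝓛.IsAlgebraic] (A : Type w) [𝓛.Structure A] [Fintype A],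
      Fintype.card A = n → IsCongruenceDistributive 𝓛 A →
        congruenceEnergy 𝓛 A ≤ ((n : ℝ) - 1) * 2 ^ (n - 1) ∧
        (congruenceEnergy 𝓛 A = ((n : ℝ) - 1) * 2 ^ (n - 1) →
          IsBooleanLattice (Congruences 𝓛 A) ∧ Nat.card (Congruences 𝓛 A) = 2 ^ (n - 1))) ∧
    -- (b) lattices
    (∀ (L : Type w) [Lattice L] [Fintype L], Fintype.card L = n →
        latticeCE L ≤ ((n : ℝ) - 1) * 2 ^ (n - 1) ∧
        (latticeCE L = ((n : ℝ) - 1) * 2 ^ (n - 1) ↔ IsChainLattice L)) ∧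
    -- (c) lattices whose congruence energy is not maximal
    (∀ (L : Type w) [Lattice L] [Fintype L], Fintype.card L = n →
        latticeCE L < ((n : ℝ) - 1) * 2 ^ (n - 1) →
        4 ≤ n ∧
        latticeCE L ≤ ((n : ℝ) - 1) * 2 ^ (n - 2) + 2 ^ (n - 3) ∧
        (latticeCE L = ((n : ℝ) - 1) * 2 ^ (n - 2) + 2 ^ (n - 3) ↔
          ∃! S : Set L, S.ncard = 2 ∧ IsAntichain (· ≤ ·) S) ∧
        (latticeCE L = ((n : ℝ) - 1) * 2 ^ (n - 2) + 2 ^ (n - 3) ↔ IsChainB4ChainSum L)) := by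
  classical
  obtain ⟨m, rfl⟩ : ∃ m, n = m + 1 := ⟨n - 1, by omega⟩
  have hmax : (((m + 1 : ℕ) : ℝ) - 1) * 2 ^ (m + 1 - 1) = ((m * 2 ^ m : ℕ) : ℝ) := by
    rw [Nat.add_sub_cancel]
    push_cast
    ring
  simp only [hmax]
  have hcard : ∀ (L : Type w) [Lattice L] [Fintype L], Fintype.card L = m + 1 →
      (supIrreds L).card + (supReds L).card = m := by
    intro L _ _ hL
    have : Nonempty L := Fintype.card_pos_iff.1 (by omega)
    have := card_supIrreds_add_card_supReds (L := L)
    omega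
  have hchain : ∀ (L : Type w) [Lattice L] [Fintype L], Fintype.card L = m + 1 →
      IsChainLattice L → latticeCE L = ((m * 2 ^ m : ℕ) : ℝ) := by
    intro L _ _ hL h
    have := Fintype.ofFinite (Congruences latticeLanguage L)
    have h1 := hcard L hL
    rw [isChainLattice_iff.1 h, add_zero] at h1
    rw [latticeCE_eq, two_mul_sum_card_nonleast_of_isChainLattice h, h1, mul_comm]
  refine ⟨fun 𝓛 _ A _ _ hA hD => ?_, fun L _ _ hL => ?_, fun L _ _ hL hlt => ?_⟩
  · exact congruenceEnergy_le_of_isCongruenceDistributive 𝓛 A hA hD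
  · have hnon : ¬ IsChainLattice L → latticeCE L < ((m * 2 ^ m : ℕ) : ℝ) := by
      intro h
      have := Fintype.ofFinite (Congruences latticeLanguage L)
      simp only [IsChainLattice, not_forall, not_or] at h
      obtain ⟨a, b, hab, hba⟩ := h
      have h4 := four_le_card_of_incomp hab hba
      have h1 := hcard L hL
      have h2 := two_mul_sum_card_nonleast_lt hab hba (by omega)
      rw [h1] at h2
      rw [latticeCE_eq, Nat.cast_lt]
      exact h2
    by_cases h : IsChainLattice L
    · exact ⟨(hchain L hL h).le, fun _ => h, fun _ => hchain L hL h⟩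
    · exact ⟨(hnon h).le, fun h' => absurd h' (hnon h).ne, fun h' => absurd h' h⟩
  · have hnc : ¬ IsChainLattice L := fun h => hlt.ne (hchain L hL h)
    have := Fintype.ofFinite (Congruences latticeLanguage L)
    simp only [IsChainLattice, not_forall, not_or] at hnc
    obtain ⟨a, b, hab, hba⟩ := hnc
    have h4 := four_le_card_of_incomp hab hba
    have h1 := hcard L hL
    rw [hL] at h4
    -- An incomparable pair forces `n = k + 4`, so the exponents `n - 2` and `n - 3` are not
    -- truncated.
    obtain ⟨k, rfl⟩ : ∃ k, m = k + 3 := ⟨m - 3, by omega⟩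
    have hsecond : (((k + 3 + 1 : ℕ) : ℝ) - 1) * 2 ^ (k + 3 + 1 - 2) + 2 ^ (k + 3 + 1 - 3) =
        ((2 ^ (k + 1) * (2 * (k + 3) + 1) : ℕ) : ℝ) := by
      rw [show k + 3 + 1 - 2 = k + 2 by omega, show k + 3 + 1 - 3 = k + 1 by omega]
      push_cast
      ring
    rw [hsecond, existsUnique_antichain_iff, ← exists_isUniqueIncompPair_iff, latticeCE_eq,
      Nat.cast_le, Nat.cast_inj]
    by_cases hu : ∃ a b : L, IsUniqueIncompPair a b
    · obtain ⟨c, d, h⟩ := id hu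
      have h2 := h.four_mul_sum_card_nonleast
      have h3 := congrArg Finset.card h.supReds_eq
      rw [Finset.card_singleton] at h3
      rw [show (supIrreds L).card = k + 2 by omega] at h2
      have heq : 2 * ∑ θ : Congruences latticeLanguage L, (nonleast θ).card =
          2 ^ (k + 1) * (2 * (k + 3) + 1) := by
        have : 2 ^ (k + 2) * (2 * (k + 2) + 3) = 2 * (2 ^ (k + 1) * (2 * (k + 3) + 1)) := by ring
        omega
      exact ⟨h4, heq.le, iff_of_true heq hu, iff_of_true heq hu⟩
    · have h2 := four_mul_sum_card_nonleast_lt hab hba fun c d h => hu ⟨c, d, h⟩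
      rw [h1] at h2
      have hlt' : 2 * ∑ θ : Congruences latticeLanguage L, (nonleast θ).card <
          2 ^ (k + 1) * (2 * (k + 3) + 1) := by
        have : 2 ^ (k + 3) * (2 * (k + 3) + 1) = 4 * (2 ^ (k + 1) * (2 * (k + 3) + 1)) := by ring
        omega
      exact ⟨h4, hlt'.le, iff_of_false hlt'.ne hu, iff_of_false hlt'.ne hu⟩
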